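/- **Setting.** Let $(M,d)$ be a metric space with a nonzero Borel measure $\mu$, $B(x,r)=\{y: d(x,y)\le r\}$, $V_x(r)=\mu(B(x,r))$. Assume that for each $x\in M$ the function $V_x$ is finite and continuous in $r$ (with $V_x(0)=0$, i.e. points have measure zero). Let $\beta>1$, $1/\beta+1/\beta'=1$, $p\ge1$, $A_0>0$, $A_\infty\ge0$. Negative powers of $0$ are read as $+\infty$. A measurable $k:M\times M\to\mathbb R$ is a *Riesz-like kernel* of order $\beta$ with normalization constants $A_0,A_\infty$ if there is $B\ge 0$ such that for all $x,y$ - (K1) $\int_{r_1\le d(x,y)\le r_2}|k(x,y)|^\beta d\mu(y)\le A_0\log\frac{V_x(r_2)}{V_x(r_1)}+B$ if $0<V_x(r_1)<V_x(r_2)\le1$; - (K2) the same with $A_\infty$ in place of $A_0$ if $1\le V_x(r_1)<V_x(r_2)$; - (K3) $|k(x,y)|\le B\,V_x(d(x,y))^{-1/\beta}$ and $|k(x,y)|\le B\,V_y(d(x,y))^{-1/\beta}$; and - (K4) for each $\delta>0$ there is $B_\delta$ with $\int_{d(x,y)>R}|k(x',y)-k(x,y)|^\beta d\mu(y)\le B_\delta$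 whenever $V_x(R)\ge(1+\delta)V_x(r)$ and $x'\in B(x,r)$. Assume that $k$ is Riesz-like; or, alternatively, that $A_\infty=0$ and that (K1), (K2), the first estimate of (K3) for $V_x(d(x,y))\le1$, (K4) for $V_x(r)\le 1$, and $\sup_x (k(x,\cdot))^*(t)\le Ct^{-1/\beta}$, $\sup_y (k(\cdot,y))^*(t)\le Ct^{-1/\beta}$ for $t>0$ hold (${}^*$ is the decreasing rearrangement). Let $Tf(x)=\int_M k(x,y)f(y)\,d\mu(y)$ and $\exp_N(t)=e^t-\sum_{i=0}^N t^i/i!$. Consider, for measurable $f$ supported in a ball, the inequalities $$\text{(1)}\quad \int_M \frac{\exp_{\lceil p/\beta-1\rceil}\big[\tfrac{1}{\max\{A_0,A_\infty\}}|Tf|^\beta\big]}{1+|Tf|^{p\beta/\beta'}}d\mu\le C\|Tf\|_p^p \quad\text{under } \|f\|_{\beta'}\le1,$$ $$\text{(2)}\quad \int_M \frac{\exp_{\lceil p/\beta-1\rceil}\big[\tfrac1{A_0}|Tf|^\beta\big]}{1+|Tf|^{p\beta/\beta'}}d\mu\le C\|Tf\|_p^p,\qquad \text{(3)}\quad \int_M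 \exp_{\lceil \beta'-2\rceil}\big[\tfrac1{A_0}|Tf|^\beta\big]d\mu\le C,$$ the last two under $\|f\|_{\beta'}^{\beta'}+\kappa\|Tf\|_{\beta'}^{\beta'}\le1$, where $\kappa\ge0$ (for $\kappa=0$ this is $\|f\|_{\beta'}\le 1$). **Regularity at a point.** Let $x_0\in M$ and suppose: (i) for some $\eta_1>0$ and each $\delta>0$ there is $C_\delta$ with $|k(x',y)-k(x_0,y)|\le C_\delta V_{x_0}(d(x_0,x'))^{\eta_1}V_{x_0}(d(x_0,y))^{-\eta_1-1/\beta}$ whenever $V_{x_0}(R)\ge(1+\delta)V_{x_0}(r)$, $x'\in B(x_0,r)$, $y\notin B(x_0,R)$; (ii) $k$ has a Taylor formula with volume remainder of order $\eta\ge0$ in $y$ at $x_0$: there are $m\ge1$ and measurable $k_j,p_j$ on $M$ ($0\le j<m$), the $p_j$ bounded on each ball $B(x_0,r)$ and linearly independent in $L^2(B(x_0,r))$ if $V_{x_0}(r)>0$, such that for each $\delta>0$ there is $C_\delta$ with $$\Big|k(x,y)-\sum_{j<m}k_j(x)p_j(y)\Big|\le C_\delta V_{x_0}(d(y,x_0))^{\eta}V_{x_0}(d(x,x_0))^{-\eta-1/\beta}$$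 whenever $V_{x_0}(R)\ge(1+\delta)V_{x_0}(r)$, $d(y,x_0)\le r$, $d(x,x_0)\ge R$; and there is $C$ such that, for every $r$ with $V_{x_0}(r)>0$, every $L^2(B(x_0,r))$-orthonormal basis $v_0,\dots,v_{m-1}$ of the span of the $p_j$ satisfies $|v_j|\le C\,V_{x_0}(r)^{-1/2}$ on $B(x_0,r)$. **Theorem.** Suppose $p>(1+p/\beta')(1+\eta)^{-1}$. (a) Suppose $k$ is proper on the diagonal at $x_0$: for some $C$, $\int_{r_1\le d(x_0,y)\le r_2}|k(x_0,y)|^\beta d\mu(y)\ge A_0\log\frac{V_{x_0}(r_2)}{V_{x_0}(r_1)}-C$ whenever $0<V_{x_0}(r_1)<V_{x_0}(r_2)\le1$. If $A_0\ge A_\infty$, then in (1) the exponential constant $1/A_0$ and the power $p\beta/\beta'$ of the denominator are sharp. For each $\kappa\ge0$, provided $\kappa=0$ or $\beta'>2(1+\eta)^{-1}$ (which is automatic if $p\le\beta'$), the exponential constant $1/A_0$ in (2) and in (3) and the power $p\beta/\beta'$ in (2) are sharp. Moreover, if the exponential constant in (1) (when $A_0\ge A_\infty$) or in (2) is replaced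 by any larger one, there are admissible $f$ with left-hand side arbitrarily large and $\|Tf\|_p^p$ arbitrarily small. (b) Suppose $k$ is proper at infinity at $x_0$: $\mu(M)=\infty$, $A_\infty>0$ and for some $C$, $\int_{r_1\le d(x_0,y)\le r_2}|k(x_0,y)|^\beta d\mu(y)\ge A_\infty\log\frac{V_{x_0}(r_2)}{V_{x_0}(r_1)}-C$ whenever $1\le V_{x_0}(r_1)<V_{x_0}(r_2)$. If $A_0\le A_\infty$, then in (1) the exponential constant $1/A_\infty$ and the power $p\beta/\beta'$ of the denominator are sharp. Here *sharp* means: if the exponential constant is replaced by any larger one, or the power of the denominator by any smaller one, then the ratio of the left-hand side to $\|Tf\|_p^p$ (with $0<\|Tf\|_p<\infty$), respectively the left-hand side of (3), is unbounded over the admissible $f$. -/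

import Mathlib

open MeasureTheory Set Metric
open scoped ENNReal Nat

noncomputable section

namespace RieszLike

variable {M : Type*} [MetricSpace M] [MeasurableSpace M]

/-- `V_x(r) = μ(B(x,r))`, where `B(x,r) = {y : d(x,y) ≤ r}`, as a real number. -/
def vol (μ : Measure M) (x : M) (r : ℝ) : ℝ := μ.real (closedBall x r)

/-- All balls have finite measure and `r ↦ V_x(r)` is continuous. Balls of negative radius are
empty, so continuity at `r = 0` says that points have measure zero. -/
structure HasContinuousVolume (μ : Measure M) : Prop where
  finite : ∀ x r, μ (closedBall x r) < ∞
  continuous : ∀ x, Continuous fun r : ℝ => vol μ x r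

/-- `∫_{r₁ ≤ d(x,y) ≤ r₂} |k(x,y)|^β dμ(y)`. -/
def annulusIntegral (μ : Measure M) (k : M → M → ℝ) (β : ℝ) (x : M) (r₁ r₂ : ℝ) : ℝ≥0∞ :=
  ∫⁻ y in {y | r₁ ≤ dist x y ∧ dist x y ≤ r₂}, ENNReal.ofReal (|k x y| ^ β) ∂μ

/-- Upper bound on the size of the kernel near the diagonal. -/
def SizeNear (μ : Measure M) (k : M → M → ℝ) (β A₀ B : ℝ) : Prop :=
  ∀ x r₁ r₂, 0 < vol μ x r₁ → vol μ x r₁ < vol μ x r₂ → vol μ x r₂ ≤ 1 →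
    annulusIntegral μ k β x r₁ r₂ ≤
      ENNReal.ofReal (A₀ * Real.log (vol μ x r₂ / vol μ x r₁) + B)

/-- Upper bound on the size of the kernel at infinity. -/
def SizeFar (μ : Measure M) (k : M → M → ℝ) (β Ainf B : ℝ) : Prop :=
  ∀ x r₁ r₂, 1 ≤ vol μ x r₁ → vol μ x r₁ < vol μ x r₂ →
    annulusIntegral μ k β x r₁ r₂ ≤
      ENNReal.ofReal (Ainf * Real.log (vol μ x r₂ / vol μ x r₁) + B)

/-- The pointwise bounds `|k(x,y)| ≤ B V_x(d(x,y))^{-1/β}` and `|k(x,y)| ≤ B V_y(d(x,y))^{-1/β}`,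
where the right-hand sides are read as `+∞` if the volume vanishes. -/
def PointwiseBound (μ : Measure M) (k : M → M → ℝ) (β B : ℝ) : Prop :=
  ∀ x y,
    (0 < vol μ x (dist x y) → |k x y| ≤ B * vol μ x (dist x y) ^ (-(1 / β))) ∧
    (0 < vol μ y (dist x y) → |k x y| ≤ B * vol μ y (dist x y) ^ (-(1 / β)))

/-- The first of the two pointwise bounds, only for `V_x(d(x,y)) ≤ 1`. -/
def PointwiseBoundNear (μ : Measure M) (k : M → M → ℝ) (β B : ℝ) : Prop :=
  ∀ x y, 0 < vol μ x (dist x y) → vol μ x (dist x y) ≤ 1 →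
    |k x y| ≤ B * vol μ x (dist x y) ^ (-(1 / β))

/-- Integral regularity of the kernel in the first variable, for given `x`, `r`. -/
def IntegralRegularAt (μ : Measure M) (k : M → M → ℝ) (β δ Bδ : ℝ) (x : M) (r : ℝ) : Prop :=
  ∀ R > 0, (1 + δ) * vol μ x r ≤ vol μ x R → ∀ x' ∈ closedBall x r,
    ∫⁻ y in {y | R < dist x y}, ENNReal.ofReal (|k x' y - k x y| ^ β) ∂μ ≤ ENNReal.ofReal Bδ

/-- Riesz-like kernels of order `β` with normalization constants `A₀`, `A_∞`. -/
structure IsRieszLike (μ : Measure M) (k : M → M → ℝ) (β A₀ Ainf : ℝ) : Prop where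
  measurable : Measurable (Function.uncurry k)
  one_lt : 1 < β
  A₀_pos : 0 < A₀
  Ainf_nonneg : 0 ≤ Ainf
  size : ∃ B ≥ 0, SizeNear μ k β A₀ B ∧ SizeFar μ k β Ainf B ∧ PointwiseBound μ k β B
  regular : ∀ δ > 0, ∃ Bδ > 0, ∀ x, ∀ r > 0, IntegralRegularAt μ k β δ Bδ x r

/-- Decreasing rearrangement `f^*(t) = inf {s ≥ 0 : μ{|f| > s} ≤ t}`, with values in `[0,∞]`. -/
def rearrangement (μ : Measure M) (f : M → ℝ) (t : ℝ) : ℝ≥0∞ :=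
  sInf {s : ℝ≥0∞ | μ {x | s < ‖f x‖ₑ} ≤ ENNReal.ofReal t}

/-- The weaker conditions on the kernel allowed in the critically integrable case `A_∞ = 0`:
the two size conditions with `A_∞ = 0`, the first pointwise bound for `V_x(d(x,y)) ≤ 1`,
integral regularity for `V_x(r) ≤ 1`, and `k_1^*(t), k_2^*(t) ≤ C t^{-1/β}` for all `t > 0`. -/
structure IsCriticalRieszLike (μ : Measure M) (k : M → M → ℝ) (β A₀ : ℝ) : Prop where
  measurable : Measurable (Function.uncurry k)
  one_lt : 1 < β
  A₀_pos : 0 < A₀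
  size : ∃ B ≥ 0, SizeNear μ k β A₀ B ∧ SizeFar μ k β 0 B ∧ PointwiseBoundNear μ k β B
  regular : ∀ δ > 0, ∃ Bδ > 0, ∀ x, ∀ r > 0, vol μ x r ≤ 1 → IntegralRegularAt μ k β δ Bδ x r
  rearr : ∃ C : ℝ, ∀ t > 0,
    (⨆ x, rearrangement μ (fun y => k x y) t) ≤ ENNReal.ofReal (C * t ^ (-(1 / β))) ∧
    (⨆ y, rearrangement μ (fun x => k x y) t) ≤ ENNReal.ofReal (C * t ^ (-(1 / β)))

/-- The kernel is proper on the diagonal, with base point `x₀`. -/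
def IsProperOnDiagonalAt (μ : Measure M) (k : M → M → ℝ) (β A₀ : ℝ) (x₀ : M) : Prop :=
  ∃ C : ℝ, ∀ r₁ r₂, 0 < vol μ x₀ r₁ → vol μ x₀ r₁ < vol μ x₀ r₂ → vol μ x₀ r₂ ≤ 1 →
    ENNReal.ofReal (A₀ * Real.log (vol μ x₀ r₂ / vol μ x₀ r₁) - C) ≤
      annulusIntegral μ k β x₀ r₁ r₂

/-- The kernel is proper at infinity, with base point `x₀`. -/
def IsProperAtInfinityAt (μ : Measure M) (k : M → M → ℝ) (β Ainf : ℝ) (x₀ : M) : Prop :=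
  μ univ = ∞ ∧ 0 < Ainf ∧
  ∃ C : ℝ, ∀ r₁ r₂, 1 ≤ vol μ x₀ r₁ → vol μ x₀ r₁ < vol μ x₀ r₂ →
    ENNReal.ofReal (Ainf * Real.log (vol μ x₀ r₂ / vol μ x₀ r₁) - C) ≤
      annulusIntegral μ k β x₀ r₁ r₂

/-- Pointwise regularity of order `η` in the first variable at `x₀`; the negative power of the
volume is read as `+∞` where the volume vanishes. -/
def IsXRegularAt (μ : Measure M) (k : M → M → ℝ) (β : ℝ) (x₀ : M) (η : ℝ) : Prop :=
  ∀ δ > 0, ∃ C : ℝ, ∀ r > 0, ∀ R > 0, (1 + δ) * vol μ x₀ r ≤ vol μ x₀ R →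
    ∀ x' ∈ closedBall x₀ r, ∀ y ∉ closedBall x₀ R, 0 < vol μ x₀ (dist x₀ y) →
      |k x' y - k x₀ y| ≤
        C * vol μ x₀ (dist x₀ x') ^ η * vol μ x₀ (dist x₀ y) ^ (-η - 1 / β)

/-- Taylor formula with volume remainder of order `η` in the second variable at `x₀`.
Linear independence on a ball is meant in `L²` of the ball (i.e. up to null sets), so that
orthonormal bases of the span with `m` elements exist on each ball of positive measure. -/
def HasTaylorFormulaAt (μ : Measure M) (k : M → M → ℝ) (β : ℝ) (x₀ : M) (η : ℝ) : Prop :=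
  ∃ m : ℕ, 1 ≤ m ∧ ∃ κ p : Fin m → M → ℝ,
    (∀ j, Measurable (κ j)) ∧ (∀ j, Measurable (p j)) ∧
    -- the `p j` are bounded on balls around `x₀`
    (∀ r > 0, ∀ j, ∃ K : ℝ, ∀ y ∈ closedBall x₀ r, |p j y| ≤ K) ∧
    -- the `p j` are linearly independent on balls around `x₀`
    (∀ r > 0, 0 < vol μ x₀ r → ∀ c : Fin m → ℝ,
      (∀ᵐ y ∂μ.restrict (closedBall x₀ r), ∑ j, c j * p j y = 0) → c = 0) ∧
    -- the remainder estimate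
    (∀ δ > 0, ∃ C : ℝ, ∀ r > 0, ∀ R > 0, (1 + δ) * vol μ x₀ r ≤ vol μ x₀ R →
      ∀ x y, dist y x₀ ≤ r → R ≤ dist x x₀ → 0 < vol μ x₀ (dist x x₀) →
        |k x y - ∑ j, κ j x * p j y| ≤
          C * vol μ x₀ (dist y x₀) ^ η * vol μ x₀ (dist x x₀) ^ (-η - 1 / β)) ∧
    -- uniform bounds for orthonormal bases of the span of the `p j` in `L²(B(x₀,r))`
    (∃ C : ℝ, ∀ r > 0, 0 < vol μ x₀ r → ∀ v : Fin m → M → ℝ,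
      (∀ j, v j ∈ Submodule.span ℝ (range p)) →
      (∀ i j, ∫ y in closedBall x₀ r, v i y * v j y ∂μ = if i = j then 1 else 0) →
      ∀ j, ∀ y ∈ closedBall x₀ r, |v j y| ≤ C / √(vol μ x₀ r))

/-- The potential `Tf(x) = ∫ k(x,y) f(y) dμ(y)`. -/
def potential (μ : Measure M) (k : M → M → ℝ) (f : M → ℝ) (x : M) : ℝ :=
  ∫ y, k x y * f y ∂μ

/-- `‖g‖_q^q`, as an element of `[0,∞]`. -/
def normPow (μ : Measure M) (q : ℝ) (g : M → ℝ) : ℝ≥0∞ :=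
  eLpNorm g (ENNReal.ofReal q) μ ^ q

/-- The functions admitted in the inequalities: measurable, supported in a ball, and with
`‖f‖_{β'}^{β'} + κ ‖Tf‖_{β'}^{β'} ≤ 1`. For `κ = 0` this is `‖f‖_{β'} ≤ 1`. -/
def Admissible (μ : Measure M) (k : M → M → ℝ) (β' κ : ℝ) (f : M → ℝ) : Prop :=
  Measurable f ∧ (∃ c R, Function.support f ⊆ closedBall c R) ∧
    normPow μ β' f + ENNReal.ofReal κ * normPow μ β' (potential μ k f) ≤ 1

/-- The regularized exponential `exp_N(t) = e^t - ∑_{i=0}^N t^i / i!`. -/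
def expReg (N : ℕ) (t : ℝ) : ℝ := Real.exp t - ∑ i ∈ Finset.range (N + 1), t ^ i / (i ! : ℝ)

/-- `∫ exp_{⌈p/β-1⌉}(γ |Tf|^β) / (1 + |Tf|^q) dμ`. -/
def growthIntegral (μ : Measure M) (k : M → M → ℝ) (β p γ q : ℝ) (f : M → ℝ) : ℝ≥0∞ :=
  ∫⁻ x, ENNReal.ofReal
    (expReg ⌈p / β - 1⌉₊ (γ * |potential μ k f x| ^ β) / (1 + |potential μ k f x| ^ q)) ∂μ

/-- `∫ exp_{⌈β'-2⌉}(γ |Tf|^β) dμ`. -/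
def rufIntegral (μ : Measure M) (k : M → M → ℝ) (β β' γ : ℝ) (f : M → ℝ) : ℝ≥0∞ :=
  ∫⁻ x, ENNReal.ofReal (expReg ⌈β' - 2⌉₊ (γ * |potential μ k f x| ^ β)) ∂μ

/-- Sharpness of the exponential constant `γ₀` in
`∫ exp_{⌈p/β-1⌉}(γ₀ |Tf|^β) / (1 + |Tf|^{pβ/β'}) dμ ≤ C ‖Tf‖_p^p`: for each larger constant the
ratio of the two sides is unbounded. -/
def ExpConstantSharp (μ : Measure M) (k : M → M → ℝ) (β β' p κ γ₀ : ℝ) : Prop :=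
  ∀ γ > γ₀, ∀ C : ℝ, ∃ f, Admissible μ k β' κ f ∧
    0 < normPow μ p (potential μ k f) ∧ normPow μ p (potential μ k f) < ∞ ∧
    ENNReal.ofReal C * normPow μ p (potential μ k f) <
      growthIntegral μ k β p γ (p * β / β') f

/-- The stronger form of sharpness of the exponential constant: for each larger constant the
left-hand side can be arbitrarily large while `‖Tf‖_p^p` is arbitrarily small. -/
def ExpConstantStronglySharp (μ : Measure M) (k : M → M → ℝ) (β β' p κ γ₀ : ℝ) : Prop :=
  ∀ γ > γ₀, ∀ C : ℝ, ∀ ε > (0 : ℝ), ∃ f, Admissible μ k β' κ f ∧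
    0 < normPow μ p (potential μ k f) ∧ normPow μ p (potential μ k f) < ENNReal.ofReal ε ∧
    ENNReal.ofReal C < growthIntegral μ k β p γ (p * β / β') f

/-- Sharpness of the power `pβ/β'` of the denominator, at the exponential constant `γ₀`: for each
smaller power the ratio of the two sides is unbounded. -/
def DenominatorPowerSharp (μ : Measure M) (k : M → M → ℝ) (β β' p κ γ₀ : ℝ) : Prop :=
  ∀ q < p * β / β', ∀ C : ℝ, ∃ f, Admissible μ k β' κ f ∧
    0 < normPow μ p (potential μ k f) ∧ normPow μ p (potential μ k f) < ∞ ∧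
    ENNReal.ofReal C * normPow μ p (potential μ k f) < growthIntegral μ k β p γ₀ q f

/-- Sharpness of the exponential constant `γ₀` in `∫ exp_{⌈β'-2⌉}(γ₀ |Tf|^β) dμ ≤ C`. -/
def RufConstantSharp (μ : Measure M) (k : M → M → ℝ) (β β' κ γ₀ : ℝ) : Prop :=
  ∀ γ > γ₀, ∀ C : ℝ, ∃ f, Admissible μ k β' κ f ∧
    ENNReal.ofReal C < rufIntegral μ k β β' γ f

end RieszLike

end

noncomputable section

namespace RieszLike

/-! The extremals are of Adams type. On an annulus `r₁ ≤ d(x₀,y) ≤ r₂` take the Hölder dual `f₀ =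
sgn(k)|k|^{β-1}` of `k(x₀,·)`. Then `Tf₀(x₀)` and `‖f₀‖_{β'}^{β'}` both equal `L`, the integral of
`|k(x₀,·)|^β` over the annulus, and properness gives `L ≥ A log(V(r₂)/V(r₁)) - C`. Regularity in the
first variable keeps `Tf₀ = L + O(1)` on a ball of volume `V(r₁)/4`.

To make the potential `p`-integrable, subtract from `f₀` its `L²(B(x₀,r₂))`-projection `b` onto the
span of the Taylor functions (`exists_correction`). With `ρ = V(r₂)`, `b` has size `O(ρ^{-1/β'})`,
hence it changes both `L` and the norm only by `O(1)` (`exists_extremal`). The moments of `f = f₀ -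
b` vanish, so `Tf` decays like `V^{-η-1/β}` away from `B(x₀,r₂)`, and the condition on `p` says
exactly that this decay is `p`-integrable at infinity. Near the ball, `f` is uniformly only in weak
`L^{β'}`, and `lintegral_mixed_rpow_le` replaces Hölder's inequality. Together: `‖Tf‖_p^p = O(ρ)`
(`lintegral_potential_rpow_le`).

All constants are independent of the annulus. Dividing by `N^{1/β'}` with `N = L + O(1)` gives an
admissible function with `|Tf|^β = N + O(1)` on a set of measure at least `cρe^{-N/A}` and `‖Tf‖_p^p
≤ CρN^{-p/β'}` (`HasExtremals`). The ratio of the two sides of the inequality is then at least a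
constant times `e^{(γ-1/A)N} N^{p/β'-q/β}` for `q ≥ 0`. It diverges if `γ > 1/A`, or if `γ = 1/A`
and `q < pβ/β'`. On the diagonal `ρ` is fixed and `r₁` shrinks; at infinity `V(r₁) = 1` and `r₂`
grows. -/

/-! ### Functions in weak `L¹` -/

/-- `h` belongs to weak `L¹`, with constant `K`. -/
def WeakOne {α : Type*} [MeasurableSpace α] (μ : Measure α) (h : α → ℝ) (K : ℝ) : Prop :=
  ∀ s > 0, μ {y | s < h y} ≤ ENNReal.ofReal (K / s)

theorem lintegral_Ioc_rpow {r T : ℝ} (hr : -1 < r) (hT : 0 ≤ T) :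
    ∫⁻ t in Ioc 0 T, ENNReal.ofReal (t ^ r) = ENNReal.ofReal (T ^ (r + 1) / (r + 1)) := by
  have hi : IntegrableOn (fun t : ℝ => t ^ r) (Ioc 0 T) :=
    (intervalIntegrable_iff_integrableOn_Ioc_of_le hT).1
      (intervalIntegral.intervalIntegrable_rpow' hr)
  rw [← ofReal_integral_eq_lintegral_ofReal hi, ← intervalIntegral.integral_of_le hT,
    integral_rpow (Or.inl hr), Real.zero_rpow (by linarith), sub_zero]
  filter_upwards [ae_restrict_mem measurableSet_Ioc] with t ht
  exact Real.rpow_nonneg ht.1.le _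

theorem lintegral_Ioi_rpow {r T : ℝ} (hr : r < -1) (hT : 0 < T) :
    ∫⁻ t in Ioi T, ENNReal.ofReal (t ^ r) = ENNReal.ofReal (T ^ (r + 1) / (-(r + 1))) := by
  rw [← ofReal_integral_eq_lintegral_ofReal (integrableOn_Ioi_rpow_of_lt hr hT),
    integral_Ioi_rpow_of_lt hr hT, neg_div, ← div_neg]
  filter_upwards [ae_restrict_mem measurableSet_Ioi] with t ht
  exact Real.rpow_nonneg (hT.trans ht).le _

section
variable {α : Type*} [MeasurableSpace α] {μ : Measure α} {h : α → ℝ} {K : ℝ}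

theorem WeakOne.setLIntegral_rpow_le (hw : WeakOne μ h K) (hK : 0 ≤ K) (hm : Measurable h)
    (h0 : ∀ y, 0 ≤ h y) {a : ℝ} (ha : 0 ≤ a) (ha1 : a < 1) {F : Set α} {m : ℝ} (hm0 : 0 < m)
    (hF : μ F ≤ ENNReal.ofReal m) :
    ∫⁻ y in F, ENNReal.ofReal (h y ^ a) ∂μ ≤
      ENNReal.ofReal ((1 + K * a / (1 - a)) * m ^ (1 - a)) := by
  rcases ha.eq_or_lt with rfl | ha
  · simpa using hF
  rw [lintegral_rpow_eq_lintegral_meas_lt_mul _ (Filter.Eventually.of_forall h0) hm.aemeasurable ha]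
  -- In the layer-cake integral, levels below `1/m` are controlled by `μ F ≤ m`, levels above by the
  -- weak bound `K/t`.
  set T := m⁻¹ with hT
  have hT0 : 0 < T := inv_pos.2 hm0
  have h1 : ∫⁻ t in Ioc 0 T, (μ.restrict F) {y | t < h y} * ENNReal.ofReal (t ^ (a - 1)) ≤
      ENNReal.ofReal (m * (T ^ a / a)) := by
    calc _ ≤ ∫⁻ t in Ioc 0 T, ENNReal.ofReal m * ENNReal.ofReal (t ^ (a - 1)) := by
          refine lintegral_mono fun t => mul_le_mul_left ?_ _
          exact (measure_mono (subset_univ _)).trans (by simpa using hF)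
      _ = _ := by
          rw [lintegral_const_mul' _ _ ENNReal.ofReal_ne_top,
            lintegral_Ioc_rpow (by linarith) hT0.le, ← ENNReal.ofReal_mul hm0.le]
          simp
  have h2 : ∫⁻ t in Ioi T, (μ.restrict F) {y | t < h y} * ENNReal.ofReal (t ^ (a - 1)) ≤
      ENNReal.ofReal (K * (T ^ (a - 1) / (1 - a))) := by
    calc _ ≤ ∫⁻ t in Ioi T, ENNReal.ofReal K * ENNReal.ofReal (t ^ (a - 2)) := by
          refine setLIntegral_mono' measurableSet_Ioi fun t ht => ?_
          have ht0 : 0 < t := hT0.trans ht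
          refine (mul_le_mul_left ((Measure.restrict_apply_le _ _).trans (hw t ht0)) _).trans_eq ?_
          rw [← ENNReal.ofReal_mul (by positivity), ← ENNReal.ofReal_mul hK,
            show a - 1 = (a - 2) + 1 by ring, Real.rpow_add_one ht0.ne']
          congr 1
          field_simp
      _ = _ := by
          rw [lintegral_const_mul' _ _ ENNReal.ofReal_ne_top,
            lintegral_Ioi_rpow (by linarith) hT0, ← ENNReal.ofReal_mul hK]
          congr 3
          all_goals ring_nf
  rw [← Ioc_union_Ioi_eq_Ioi hT0.le]
  refine (mul_le_mul_right ((lintegral_union_le _ _ _).trans (add_le_add h1 h2)) _).trans_eq ?_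
  have ha' : 0 < 1 - a := by linarith
  rw [← ENNReal.ofReal_add (by positivity) (by positivity), ← ENNReal.ofReal_mul ha.le]
  congr 1
  have e1 : T ^ a = m ^ (-a) := by rw [hT, Real.inv_rpow hm0.le, Real.rpow_neg hm0.le]
  have e2 : T ^ (a - 1) = m ^ (1 - a) := by
    rw [hT, Real.inv_rpow hm0.le, ← Real.rpow_neg hm0.le, neg_sub]
  have e3 : m ^ (1 - a) = m * m ^ (-a) := by
    rw [show 1 - a = -a + 1 by ring, Real.rpow_add_one hm0.ne', mul_comm]
  rw [e2, e1, e3]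
  field_simp

theorem WeakOne.setLIntegral_rpow_le_of_le (hw : WeakOne μ h K) (hK : 0 ≤ K) (hm : Measurable h)
    (h0 : ∀ y, 0 ≤ h y) {b : ℝ} (hb : 1 < b) {T : ℝ} (hT0 : 0 < T) :
    ∫⁻ y in {y | h y ≤ T}, ENNReal.ofReal (h y ^ b) ∂μ ≤
      ENNReal.ofReal (K * b / (b - 1) * T ^ (b - 1)) := by
  have hb0 : 0 < b := by linarith
  have hb1 : 0 < b - 1 := by linarith
  rw [lintegral_rpow_eq_lintegral_meas_lt_mul _ (Filter.Eventually.of_forall h0) hm.aemeasurable hb0]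
  have h1 : ∫⁻ t in Ioc 0 T, (μ.restrict {y | h y ≤ T}) {y | t < h y} *
      ENNReal.ofReal (t ^ (b - 1)) ≤ ENNReal.ofReal (K * (T ^ (b - 1) / (b - 1))) := by
    calc _ ≤ ∫⁻ t in Ioc 0 T, ENNReal.ofReal K * ENNReal.ofReal (t ^ (b - 2)) := by
          refine setLIntegral_mono' measurableSet_Ioc fun t ht => ?_
          have ht0 : 0 < t := ht.1
          refine (mul_le_mul_left ((Measure.restrict_apply_le _ _).trans (hw t ht0)) _).trans_eq ?_
          rw [← ENNReal.ofReal_mul (by positivity), ← ENNReal.ofReal_mul hK,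
            show b - 1 = (b - 2) + 1 by ring, Real.rpow_add_one ht0.ne']
          congr 1
          field_simp
      _ = _ := by
          rw [lintegral_const_mul' _ _ ENNReal.ofReal_ne_top,
            lintegral_Ioc_rpow (by linarith) hT0.le, ← ENNReal.ofReal_mul hK]
          congr 3
          all_goals ring_nf
  have h2 : ∫⁻ t in Ioi T, (μ.restrict {y | h y ≤ T}) {y | t < h y} *
      ENNReal.ofReal (t ^ (b - 1)) = 0 := by
    refine (setLIntegral_congr_fun measurableSet_Ioi fun t ht => ?_).trans lintegral_zero
    have : (μ.restrict {y | h y ≤ T}) {y | t < h y} = 0 := by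
      rw [Measure.restrict_apply (measurableSet_lt measurable_const hm)]
      convert measure_empty (μ := μ)
      ext y
      simp only [mem_inter_iff, mem_ofPred_eq, mem_empty_iff_false, iff_false, not_and, not_le]
      exact fun hy => lt_trans ht hy
    simp [this]
  rw [← Ioc_union_Ioi_eq_Ioi hT0.le]
  refine (mul_le_mul_right ((lintegral_union_le _ _ _).trans (add_le_add h1 h2.le)) _).trans_eq ?_
  rw [add_zero, ← ENNReal.ofReal_mul hb0.le]
  congr 1
  ring

end

/-! ### Volume of balls and weak type of the kernel -/

section
variable {M : Type*} [MetricSpace M] [MeasurableSpace M] {μ : Measure M}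

theorem vol_nonneg (x : M) (r : ℝ) : 0 ≤ vol μ x r := measureReal_nonneg

theorem HasContinuousVolume.ofReal_vol (hv : HasContinuousVolume μ) (x : M) (r : ℝ) :
    ENNReal.ofReal (vol μ x r) = μ (closedBall x r) :=
  ENNReal.ofReal_toReal (hv.finite x r).ne

theorem HasContinuousVolume.vol_mono (hv : HasContinuousVolume μ) (x : M) :
    Monotone (vol μ x) := fun _ r h =>
  measureReal_mono (closedBall_subset_closedBall h) (hv.finite x r).ne

theorem vol_of_neg (x : M) {r : ℝ} (hr : r < 0) : vol μ x r = 0 := by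
  simp [vol, closedBall_eq_empty.2 hr]

theorem HasContinuousVolume.vol_zero (hv : HasContinuousVolume μ) (x : M) : vol μ x 0 = 0 := by
  have h1 : Filter.Tendsto (vol μ x) (nhdsWithin 0 (Iio 0)) (nhds (vol μ x 0)) :=
    ((hv.continuous x).tendsto 0).mono_left nhdsWithin_le_nhds
  refine tendsto_nhds_unique h1 ?_
  refine tendsto_const_nhds.congr' ?_
  filter_upwards [self_mem_nhdsWithin] with r hr
  exact (vol_of_neg x hr).symm

theorem HasContinuousVolume.pos_of_vol_pos (hv : HasContinuousVolume μ) {x : M} {r : ℝ}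
    (h : 0 < vol μ x r) : 0 < r := by
  by_contra! hr
  have := hv.vol_mono x hr
  rw [hv.vol_zero] at this
  linarith

theorem HasContinuousVolume.lt_of_vol_lt (hv : HasContinuousVolume μ) {x : M} {r s : ℝ}
    (h : vol μ x r < vol μ x s) : r < s := (hv.vol_mono x).reflect_lt h

theorem HasContinuousVolume.exists_vol_eq (hv : HasContinuousVolume μ) {x : M} {t r : ℝ}
    (ht : 0 < t) (htr : t ≤ vol μ x r) : ∃ s, 0 < s ∧ vol μ x s = t := by
  have hr : 0 < r := hv.pos_of_vol_pos (ht.trans_le htr)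
  obtain ⟨s, -, hs⟩ := intermediate_value_Icc hr.le (hv.continuous x).continuousOn
    (show t ∈ Icc (vol μ x 0) (vol μ x r) from ⟨by rw [hv.vol_zero]; exact ht.le, htr⟩)
  have hs' : vol μ x s = t := hs
  exact ⟨s, hv.pos_of_vol_pos (hs' ▸ ht), hs'⟩

theorem HasContinuousVolume.exists_lt_vol (hv : HasContinuousVolume μ) (x : M) {c : ℝ}
    (hc : ENNReal.ofReal c < μ univ) : ∃ r, c < vol μ x r := by
  by_contra! h
  refine hc.not_ge ?_
  have hmono : Monotone fun n : ℕ => closedBall x (n : ℝ) := fun m n hmn =>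
    closedBall_subset_closedBall (by exact_mod_cast hmn)
  rw [← iUnion_closedBall_nat x, hmono.measure_iUnion]
  refine iSup_le fun n => ?_
  rw [← hv.ofReal_vol]
  exact ENNReal.ofReal_le_ofReal (h n)

theorem HasContinuousVolume.sigmaFinite (hv : HasContinuousVolume μ) [Nonempty M] :
    SigmaFinite μ := by
  obtain ⟨x⟩ := ‹Nonempty M›
  exact ⟨⟨⟨fun n : ℕ => closedBall x n, fun _ => trivial, fun n => hv.finite x n,
    iUnion_closedBall_nat x⟩⟩⟩

/-- Continuity of the volume makes the largest radius with volume at most `t` attained, so the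
sublevel set lies in that closed ball. If `t` is at least the total mass there need be no largest
radius, but the bound is trivial. -/
theorem HasContinuousVolume.measure_vol_dist_le (hv : HasContinuousVolume μ) (x : M) {t : ℝ}
    (ht : 0 ≤ t) : μ {y | vol μ x (dist x y) ≤ t} ≤ ENNReal.ofReal t := by
  by_cases hc : ENNReal.ofReal t < μ univ
  · obtain ⟨r, hr⟩ := hv.exists_lt_vol x hc
    set S := {s : ℝ | vol μ x s ≤ t} with hS
    have hb : BddAbove S := ⟨r, fun s hs => (hv.lt_of_vol_lt (lt_of_le_of_lt hs hr)).le⟩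
    have hne : S.Nonempty := ⟨0, by simp [hS, hv.vol_zero, ht]⟩
    have hcl : IsClosed S := isClosed_le (hv.continuous x) continuous_const
    have hmem : sSup S ∈ S := hcl.csSup_mem hne hb
    calc _ ≤ μ (closedBall x (sSup S)) := by
          refine measure_mono fun y hy => ?_
          rw [mem_closedBall, dist_comm]
          exact le_csSup hb hy
      _ ≤ _ := by
          rw [← hv.ofReal_vol]
          exact ENNReal.ofReal_le_ofReal hmem
  · exact (measure_mono (subset_univ _)).trans (not_lt.1 hc)

theorem HasContinuousVolume.measurable_vol_dist [BorelSpace M] (hv : HasContinuousVolume μ)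
    (x : M) : Measurable fun y => vol μ x (dist x y) :=
  ((hv.continuous x).comp (continuous_const.dist continuous_id)).measurable

/-- `1 / V_x(d(x,y))`, with the value `0` where the volume vanishes. -/
def invVol (μ : Measure M) (x y : M) : ℝ := (vol μ x (dist x y))⁻¹

theorem invVol_nonneg (x y : M) : 0 ≤ invVol μ x y := inv_nonneg.2 (vol_nonneg _ _)

theorem HasContinuousVolume.measurable_invVol [BorelSpace M] (hv : HasContinuousVolume μ)
    (x : M) : Measurable (invVol μ x) := (hv.measurable_vol_dist x).inv

theorem HasContinuousVolume.weakOne_invVol (hv : HasContinuousVolume μ) (x : M) :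
    WeakOne μ (invVol μ x) 1 := by
  intro s hs
  refine (measure_mono fun y hy => ?_).trans (hv.measure_vol_dist_le x (by positivity))
  have hy : s < invVol μ x y := hy
  have h1 : 0 < vol μ x (dist x y) := inv_pos.1 (hs.trans hy)
  have := (lt_inv_comm₀ hs h1).1 hy
  simpa using this.le

theorem HasContinuousVolume.ae_vol_dist_pos (hv : HasContinuousVolume μ) (x : M) :
    ∀ᵐ y ∂μ, 0 < vol μ x (dist x y) := by
  rw [ae_iff]
  have := hv.measure_vol_dist_le x le_rfl
  simpa using this

theorem HasContinuousVolume.weakOne_of_bound (hv : HasContinuousVolume μ) {β B : ℝ} (hβ : 0 < β)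
    (hB : 0 ≤ B) (x : M) (g : M → ℝ)
    (hg : ∀ y, 0 < vol μ x (dist x y) → |g y| ≤ B * vol μ x (dist x y) ^ (-(1 / β))) :
    WeakOne μ (fun y => |g y| ^ β) (B ^ β) := by
  intro s hs
  have h1 : μ {y | s < |g y| ^ β} ≤ μ {y | vol μ x (dist x y) ≤ B ^ β / s} := by
    refine measure_mono_ae ?_
    filter_upwards [hv.ae_vol_dist_pos x] with y hy hys
    have hys : s < |g y| ^ β := hys
    have h2 : |g y| ^ β ≤ B ^ β * (vol μ x (dist x y))⁻¹ := by
      refine (Real.rpow_le_rpow (abs_nonneg _) (hg y hy) hβ.le).trans_eq ?_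
      rw [Real.mul_rpow hB (by positivity), ← Real.rpow_mul hy.le, ← Real.rpow_neg_one]
      congr 2
      field_simp
    change vol μ x (dist x y) ≤ B ^ β / s
    rw [le_div_iff₀ hs]
    have h3 := hys.le.trans h2
    rw [← div_eq_mul_inv, le_div_iff₀ hy] at h3
    linarith
  exact h1.trans (hv.measure_vol_dist_le x (by positivity))

theorem weakOne_of_rearrangement {α : Type*} [MeasurableSpace α] {μ : Measure α} {β C : ℝ}
    (hβ : 0 < β) (g : α → ℝ)
    (hg : ∀ t > 0, rearrangement μ g t ≤ ENNReal.ofReal (C * t ^ (-(1 / β)))) :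
    WeakOne μ (fun y => |g y| ^ β) ((|C| + 1) ^ β) := by
  intro s hs
  -- Enlarging `C` gives a strict inequality below, which is needed to extract from the infimum a
  -- level smaller than `s^{1/β}`.
  have hC : 0 < |C| + 1 := by positivity
  set t := (|C| + 1) ^ β / s with ht
  have ht0 : 0 < t := by positivity
  have h1 : C * t ^ (-(1 / β)) < s ^ (1 / β) := by
    have : t ^ (-(1 / β)) = s ^ (1 / β) / (|C| + 1) := by
      rw [Real.rpow_neg ht0.le, ht, Real.div_rpow (by positivity) hs.le, ← Real.rpow_mul hC.le,
        mul_one_div_cancel hβ.ne', Real.rpow_one, inv_div]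
    rw [this, ← mul_div_assoc, div_lt_iff₀ hC, mul_comm]
    have hs' : 0 < s ^ (1 / β) := by positivity
    exact mul_lt_mul_of_pos_left (by linarith [le_abs_self C]) hs'
  have h2 := (hg t ht0).trans_lt ((ENNReal.ofReal_lt_ofReal_iff (by positivity)).2 h1)
  obtain ⟨a, ha, has⟩ := sInf_lt_iff.1 h2
  refine (measure_mono fun y hy => ?_).trans ha
  have hy : s < |g y| ^ β := hy
  refine has.trans_le ?_
  rw [← ofReal_norm, Real.norm_eq_abs]
  refine ENNReal.ofReal_le_ofReal ?_
  calc s ^ (1 / β) ≤ (|g y| ^ β) ^ (1 / β) := Real.rpow_le_rpow hs.le hy.le (by positivity)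
    _ = |g y| := by
      rw [← Real.rpow_mul (abs_nonneg _), mul_one_div_cancel hβ.ne', Real.rpow_one]

theorem IsRieszLike.exists_weakOne (hv : HasContinuousVolume μ) {k : M → M → ℝ} {β A₀ Ainf : ℝ}
    (hk : IsRieszLike μ k β A₀ Ainf) : ∃ K ≥ 0,
      (∀ x, WeakOne μ (fun y => |k x y| ^ β) K) ∧ ∀ y, WeakOne μ (fun x => |k x y| ^ β) K := by
  obtain ⟨B, hB, -, -, hb⟩ := hk.size
  have hβ : 0 < β := zero_lt_one.trans hk.one_lt
  refine ⟨B ^ β, by positivity, fun x => ?_, fun y => ?_⟩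
  · exact hv.weakOne_of_bound hβ hB x _ fun y => (hb x y).1
  · refine hv.weakOne_of_bound hβ hB y _ fun x => ?_
    rw [dist_comm]
    exact (hb x y).2

theorem IsCriticalRieszLike.exists_weakOne {k : M → M → ℝ} {β A₀ : ℝ}
    (hk : IsCriticalRieszLike μ k β A₀) : ∃ K ≥ 0,
      (∀ x, WeakOne μ (fun y => |k x y| ^ β) K) ∧ ∀ y, WeakOne μ (fun x => |k x y| ^ β) K := by
  obtain ⟨C, hC⟩ := hk.rearr
  have hβ : 0 < β := zero_lt_one.trans hk.one_lt
  refine ⟨(|C| + 1) ^ β, by positivity, fun x => ?_, fun y => ?_⟩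
  · exact weakOne_of_rearrangement hβ _ fun t ht => iSup_le_iff.1 (hC t ht).1 x
  · exact weakOne_of_rearrangement hβ _ fun t ht => iSup_le_iff.1 (hC t ht).2 y

end

/-! ### Mixed weak type estimate -/

theorem rpow_mul_rpow_le_add {x y u w : ℝ} (hx : 0 ≤ x) (hy : 0 ≤ y) (hu : 0 ≤ u) (hw : 0 ≤ w) :
    x ^ u * y ^ w ≤ x ^ (u + w) + y ^ (u + w) := by
  rcases le_total x y with h | h
  · calc x ^ u * y ^ w ≤ y ^ u * y ^ w := by gcongr
      _ = y ^ (u + w) := (Real.rpow_add_of_nonneg hy hu hw).symm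
      _ ≤ _ := le_add_of_nonneg_left (by positivity)
  · calc x ^ u * y ^ w ≤ x ^ u * x ^ w := by gcongr
      _ = x ^ (u + w) := (Real.rpow_add_of_nonneg hx hu hw).symm
      _ ≤ _ := le_add_of_nonneg_right (by positivity)

theorem ENNReal_rpow_le_one_add_rpow (x : ℝ≥0∞) {q Q : ℝ} (hq : 0 ≤ q) (hQ : q ≤ Q) :
    x ^ q ≤ 1 + x ^ Q := by
  rcases le_total x 1 with h | h
  · exact (ENNReal.rpow_le_one h hq).trans le_self_add
  · exact (ENNReal.rpow_le_rpow_of_exponent_le h hQ).trans le_add_self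

section
variable {α : Type*} [MeasurableSpace α] {μ : Measure α} [SFinite μ] {H : α → α → ℝ} {h : α → ℝ}
  {K : ℝ}

/-- With `H = |k|^β` and `h = 1/V`, the inner integral dominates `|Tf|`. Weak `L^β` against weak
`L^{β'}` just fails for Hölder's inequality, and the inner integral has no uniform bound in `x`.
Averaging over `x` repairs this, since the kernel is also of weak type in `x`. -/
theorem lintegral_mixed_rpow_le (hHm : Measurable (Function.uncurry H)) (hH0 : ∀ x y, 0 ≤ H x y)
    (hH₁ : ∀ x, WeakOne μ (H x) K) (hH₂ : ∀ y, WeakOne μ (fun x => H x y) K)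
    (hm : Measurable h) (h0 : ∀ y, 0 ≤ h y) (hw : WeakOne μ h K) (hK : 0 ≤ K)
    {β β' q : ℝ} (hβ : β.HolderConjugate β') (hq : 0 ≤ q) :
    ∃ C ≥ 0, ∀ ρ > 0, ∀ E F : Set α, μ E ≤ ENNReal.ofReal (2 * ρ) → μ F ≤ ENNReal.ofReal ρ →
      ∫⁻ x in E, (∫⁻ y in F, ENNReal.ofReal (H x y ^ (1 / β) * h y ^ (1 / β')) ∂μ) ^ q ∂μ ≤
        ENNReal.ofReal (C * ρ) := by
  have hβ0 := hβ.pos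
  have hβ0' := hβ.symm.pos
  have hβ1 := hβ.lt
  have hβ1' := hβ.symm.lt
  -- A larger exponent costs only `μ E`, because `t^q ≤ 1 + t^Q`. Taking `Q ≥ β, β'` makes `u` and
  -- `w` below nonnegative.
  set Q : ℝ := q + β + β' with hQ
  have hQ2 : 2 < Q := by linarith
  have hQ1 : 0 < Q - 1 := by linarith
  have hQQ : Q.HolderConjugate (Q / (Q - 1)) := Real.HolderConjugate.conjExponent (by linarith)
  set Q' : ℝ := Q / (Q - 1) with hQ'
  have hQ'0 : 0 < Q' := hQQ.symm.pos
  -- The integrand is written as `H^u h^w · (Hh)^{(3/4)/Q}` and Hölder is applied with `Q'`, `Q`.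
  -- Any number in `(1/2, 1)` could replace `3/4`: being below `1` makes the powers of `H` and `h`
  -- integrable on sets of finite measure, and exceeding `1/2` makes the total degree `s` of the
  -- first factor, after raising to `Q'`, less than `1`.
  set u : ℝ := 1 / β - 3 / 4 / Q with hu
  set w : ℝ := 1 / β' - 3 / 4 / Q with hwd
  have hu0 : 0 ≤ u := by
    rw [hu, sub_nonneg, div_div, div_le_div_iff₀ (by positivity) hβ0]; nlinarith
  have hw0 : 0 ≤ w := by
    rw [hwd, sub_nonneg, div_div, div_le_div_iff₀ (by positivity) hβ0']; nlinarith
  set s : ℝ := (Q - 3 / 2) / (Q - 1) with hs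
  have hs0 : 0 ≤ s := div_nonneg (by linarith) hQ1.le
  have hs1 : s < 1 := by rw [hs, div_lt_one hQ1]; linarith
  have hsum : u * Q' + w * Q' = s := by
    have h1 : 1 / β + 1 / β' = 1 := by simpa using hβ.inv_add_inv_eq_one
    have : u * Q' + w * Q' = ((1 / β + 1 / β') - 3 / 2 / Q) * Q' := by rw [hu, hwd]; ring
    rw [this, h1, hs, hQ']
    field_simp
  set c : ℝ := 1 + K * s / (1 - s) with hc
  have h1s : 0 < 1 - s := by linarith
  have hc0 : 0 < c := by positivity
  set c' : ℝ := 1 + K * (3 / 4) / (1 - 3 / 4) with hc'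
  have hc'0 : 0 < c' := by rw [hc']; norm_num; positivity
  refine ⟨2 + (2 * c) ^ (Q - 1) * (c' * 2 ^ (1 / 4 : ℝ) * c'), by positivity, ?_⟩
  intro ρ hρ E F hE hF
  have hHx : ∀ x, Measurable (H x) := fun x => hHm.of_uncurry_left
  have hHy : ∀ y, Measurable fun x => H x y := fun y => hHm.of_uncurry_right
  have key : ∀ x, (∫⁻ y in F, ENNReal.ofReal (H x y ^ (1 / β) * h y ^ (1 / β')) ∂μ) ^ Q ≤
      ENNReal.ofReal ((2 * c) ^ (Q - 1) * ρ ^ (1 / 2 : ℝ)) *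
        ∫⁻ y in F, ENNReal.ofReal (h y ^ (3 / 4 : ℝ)) * ENNReal.ofReal (H x y ^ (3 / 4 : ℝ)) ∂μ := by
    intro x
    have hsplit : ∀ y, ENNReal.ofReal (H x y ^ (1 / β) * h y ^ (1 / β')) =
        ENNReal.ofReal (H x y ^ u * h y ^ w) *
          ENNReal.ofReal ((H x y * h y) ^ (3 / 4 / Q : ℝ)) := by
      intro y
      rw [← ENNReal.ofReal_mul (by have := hH0 x y; have := h0 y; positivity),
        Real.mul_rpow (hH0 x y) (h0 y)]
      have e1 : H x y ^ (1 / β) = H x y ^ u * H x y ^ (3 / 4 / Q) := by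
        rw [← Real.rpow_add_of_nonneg (hH0 x y) hu0 (by positivity), hu, sub_add_cancel]
      have e2 : h y ^ (1 / β') = h y ^ w * h y ^ (3 / 4 / Q) := by
        rw [← Real.rpow_add_of_nonneg (h0 y) hw0 (by positivity), hwd, sub_add_cancel]
      rw [e1, e2]
      congr 1
      ring
    simp_rw [hsplit]
    have hold := ENNReal.lintegral_mul_le_Lp_mul_Lq (μ.restrict F) hQQ.symm
      (f := fun y => ENNReal.ofReal (H x y ^ u * h y ^ w))
      (g := fun y => ENNReal.ofReal ((H x y * h y) ^ (3 / 4 / Q : ℝ)))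
      (((hHx x).pow_const _).mul (hm.pow_const _)).ennreal_ofReal.aemeasurable
      ((((hHx x).mul hm).pow_const _)).ennreal_ofReal.aemeasurable
    refine (ENNReal.rpow_le_rpow hold (by linarith : 0 ≤ Q)).trans ?_
    rw [ENNReal.mul_rpow_of_nonneg _ _ (by linarith : 0 ≤ Q), ← ENNReal.rpow_mul,
      ← ENNReal.rpow_mul, one_div_mul_cancel (by linarith : Q ≠ 0), ENNReal.rpow_one]
    have hexp : 1 / Q' * Q = Q - 1 := by rw [hQ']; field_simp
    rw [hexp]
    refine mul_le_mul' ?_ (lintegral_mono fun y => ?_)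
    · have hb : ∫⁻ y in F, ENNReal.ofReal (H x y ^ u * h y ^ w) ^ Q' ∂μ ≤
          ENNReal.ofReal (2 * c * ρ ^ (1 - s)) := by
        calc _ ≤ ∫⁻ y in F, (ENNReal.ofReal (H x y ^ s) + ENNReal.ofReal (h y ^ s)) ∂μ := by
              refine lintegral_mono fun y => ?_
              have hx0 := hH0 x y
              have hy0 := h0 y
              dsimp only
              rw [ENNReal.ofReal_rpow_of_nonneg (by positivity) hQ'0.le,
                ← ENNReal.ofReal_add (by positivity) (by positivity)]
              refine ENNReal.ofReal_le_ofReal ?_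
              rw [Real.mul_rpow (by positivity) (by positivity), ← Real.rpow_mul hx0,
                ← Real.rpow_mul hy0, ← hsum]
              exact rpow_mul_rpow_le_add hx0 hy0 (by positivity) (by positivity)
          _ = ∫⁻ y in F, ENNReal.ofReal (H x y ^ s) ∂μ + ∫⁻ y in F, ENNReal.ofReal (h y ^ s) ∂μ :=
              lintegral_add_left ((hHx x).pow_const _).ennreal_ofReal _
          _ ≤ ENNReal.ofReal (c * ρ ^ (1 - s)) + ENNReal.ofReal (c * ρ ^ (1 - s)) :=
              add_le_add ((hH₁ x).setLIntegral_rpow_le hK (hHx x) (hH0 x) hs0 hs1 hρ hF)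
                (hw.setLIntegral_rpow_le hK hm h0 hs0 hs1 hρ hF)
          _ = _ := by
              rw [← ENNReal.ofReal_add (by positivity) (by positivity)]
              congr 1
              ring
      refine (ENNReal.rpow_le_rpow hb hQ1.le).trans_eq ?_
      rw [ENNReal.ofReal_rpow_of_nonneg (by positivity) hQ1.le,
        Real.mul_rpow (by positivity) (by positivity), ← Real.rpow_mul hρ.le]
      congr 3
      rw [hs]
      field_simp
      ring
    · have hx0 := hH0 x y
      have hy0 := h0 y
      dsimp only
      rw [ENNReal.ofReal_rpow_of_nonneg (by positivity) (by linarith), ← Real.rpow_mul (by positivity),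
        div_mul_cancel₀ _ (by linarith : Q ≠ 0), Real.mul_rpow hx0 hy0,
        ENNReal.ofReal_mul (by positivity), mul_comm]
  have hinner : ∫⁻ x in E, ∫⁻ y in F, ENNReal.ofReal (h y ^ (3 / 4 : ℝ)) *
      ENNReal.ofReal (H x y ^ (3 / 4 : ℝ)) ∂μ ∂μ ≤
        ENNReal.ofReal (c' * 2 ^ (1 / 4 : ℝ) * c' * ρ ^ (1 / 2 : ℝ)) := by
    have hmeas : AEMeasurable (Function.uncurry fun x y => ENNReal.ofReal (h y ^ (3 / 4 : ℝ)) *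
        ENNReal.ofReal (H x y ^ (3 / 4 : ℝ))) ((μ.restrict E).prod (μ.restrict F)) :=
      ((((hm.comp measurable_snd).pow_const _).ennreal_ofReal).mul
        ((hHm.pow_const _).ennreal_ofReal)).aemeasurable
    -- Integrating in `x` first decouples the product: the weak bound in `x` removes `H` uniformly
    -- in `y`, and each factor contributes `ρ^{1/4}`.
    rw [lintegral_lintegral_swap hmeas]
    calc _ ≤ ∫⁻ y in F, ENNReal.ofReal (h y ^ (3 / 4 : ℝ)) *
          ENNReal.ofReal (c' * (2 * ρ) ^ (1 - 3 / 4 : ℝ)) ∂μ := by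
          refine lintegral_mono fun y => ?_
          dsimp only
          rw [lintegral_const_mul' _ _ ENNReal.ofReal_ne_top]
          gcongr
          exact (hH₂ y).setLIntegral_rpow_le hK (hHy y) (fun x => hH0 x y) (by norm_num)
            (by norm_num) (by positivity) hE
      _ ≤ ENNReal.ofReal (c' * ρ ^ (1 - 3 / 4 : ℝ)) *
          ENNReal.ofReal (c' * (2 * ρ) ^ (1 - 3 / 4 : ℝ)) := by
          rw [lintegral_mul_const' _ _ ENNReal.ofReal_ne_top]
          gcongr
          exact hw.setLIntegral_rpow_le hK hm h0 (by norm_num) (by norm_num) hρ hF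
      _ = _ := by
          rw [← ENNReal.ofReal_mul (by positivity)]
          congr 1
          rw [Real.mul_rpow (by norm_num) hρ.le, show (1 / 2 : ℝ) = 1 / 4 + 1 / 4 by norm_num,
            Real.rpow_add hρ, show (1 - 3 / 4 : ℝ) = 1 / 4 by norm_num]
          ring
  calc _ ≤ ∫⁻ x in E, (1 + (∫⁻ y in F, ENNReal.ofReal (H x y ^ (1 / β) * h y ^ (1 / β')) ∂μ) ^ Q)
        ∂μ := lintegral_mono fun x => ENNReal_rpow_le_one_add_rpow _ hq (by linarith)
    _ = μ E + ∫⁻ x in E, (∫⁻ y in F, ENNReal.ofReal (H x y ^ (1 / β) * h y ^ (1 / β')) ∂μ) ^ Q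
        ∂μ := by rw [lintegral_add_left measurable_const]; simp
    _ ≤ ENNReal.ofReal (2 * ρ) + ENNReal.ofReal ((2 * c) ^ (Q - 1) * ρ ^ (1 / 2 : ℝ)) *
        ENNReal.ofReal (c' * 2 ^ (1 / 4 : ℝ) * c' * ρ ^ (1 / 2 : ℝ)) := by
        refine add_le_add hE ((lintegral_mono key).trans ?_)
        rw [lintegral_const_mul' _ _ ENNReal.ofReal_ne_top]
        gcongr
    _ = _ := by
        rw [← ENNReal.ofReal_mul (by positivity), ← ENNReal.ofReal_add (by positivity)
          (by positivity)]
        congr 1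
        have : ρ = ρ ^ (1 / 2 : ℝ) * ρ ^ (1 / 2 : ℝ) := by
          rw [← Real.rpow_add hρ]; norm_num
        linear_combination (-((2 * c) ^ (Q - 1) * (c' * 2 ^ (1 / 4 : ℝ) * c'))) * this

end

/-! ### Orthogonalization of finitely many functions -/

section
variable {α : Type*} [MeasurableSpace α] {ν : Measure α} {m : ℕ} {p : Fin m → α → ℝ}

/-- Finitely many square-integrable functions which are linearly independent up to null sets have
an orthonormal basis, consisting of honest linear combinations. -/
theorem exists_orthonormal_combinations (hp : ∀ j, MemLp (p j) 2 ν)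
    (hli : ∀ c : Fin m → ℝ, (∀ᵐ y ∂ν, ∑ j, c j * p j y = 0) → c = 0) :
    ∃ v : Fin m → α → ℝ, (∀ j, v j ∈ Submodule.span ℝ (range p)) ∧
      (∀ i j, ∫ y, v i y * v j y ∂ν = if i = j then 1 else 0) ∧
      ∀ j, ∃ d : Fin m → ℝ, ∀ y, p j y = ∑ i, d i * v i y := by
  set P : (Fin m → ℝ) →ₗ[ℝ] (α → ℝ) := Fintype.linearCombination ℝ p with hPdef
  have hPapp : ∀ c y, P c y = ∑ j, c j * p j y := by
    intro c y
    simp [hPdef, Fintype.linearCombination_apply, Finset.sum_apply]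
  -- Gram–Schmidt is run on `L²` classes, but through coefficient vectors: the map `Φ` below is
  -- injective by independence, so every class in its range has a canonical representative that is a
  -- genuine linear combination.
  have hP : ∀ c, MemLp (P c) 2 ν := by
    intro c
    rw [hPdef, Fintype.linearCombination_apply]
    exact memLp_finsetSum' _ fun j _ => (hp j).const_smul (c j)
  let Φ : (Fin m → ℝ) →ₗ[ℝ] Lp ℝ 2 ν :=
    { toFun := fun c => (hP c).toLp
      map_add' := fun c c' => by
        rw [← MemLp.toLp_add]
        exact MemLp.toLp_congr _ _ (by rw [map_add])
      map_smul' := fun a c => by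
        rw [RingHom.id_apply, ← MemLp.toLp_const_smul]
        exact MemLp.toLp_congr _ _ (by rw [map_smul]) }
  have hΦ : ∀ c, Φ c =ᵐ[ν] P c := fun c => (hP c).coeFn_toLp
  have hker : LinearMap.ker Φ = ⊥ := by
    refine LinearMap.ker_eq_bot'.2 fun c hc => hli c ?_
    have h1 : ∀ᵐ y ∂ν, (Φ c) y = 0 := by
      rw [hc]
      exact Lp.coeFn_zero ℝ 2 ν
    filter_upwards [h1, hΦ c] with y hy hy'
    rw [← hPapp, ← hy', hy]
  set u : Fin m → Lp ℝ 2 ν := fun j => Φ (Pi.single j 1) with hu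
  have hlu : LinearIndependent ℝ u := by
    have := (Pi.basisFun ℝ (Fin m)).linearIndependent.map' Φ hker
    have hue : u = Φ ∘ Pi.basisFun ℝ (Fin m) := by
      ext1 j
      simp [hu]
    rw [hue]
    exact this
  set e := InnerProductSpace.gramSchmidtNormed ℝ u with he
  have hon : Orthonormal ℝ e := InnerProductSpace.gramSchmidtNormed_orthonormal hlu
  have hspan : Submodule.span ℝ (range e) = Submodule.span ℝ (range u) := by
    rw [he, InnerProductSpace.span_gramSchmidtNormed_range, InnerProductSpace.span_gramSchmidt]
  have hex : ∀ j, ∃ c, Φ c = e j := by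
    intro j
    have h1 : e j ∈ Submodule.span ℝ (range u) := hspan ▸ Submodule.subset_span (mem_range_self j)
    have h2 : Submodule.span ℝ (range u) ≤ LinearMap.range Φ := by
      rw [Submodule.span_le]
      rintro _ ⟨i, rfl⟩
      exact ⟨_, rfl⟩
    exact h2 h1
  choose c hc using hex
  refine ⟨fun j => P (c j), fun j => ?_, fun i j => ?_, fun j => ?_⟩
  · rw [← Fintype.range_linearCombination ℝ p]
    exact ⟨c j, rfl⟩
  · have h1 := orthonormal_iff_ite.1 hon i j
    rw [L2.inner_def] at h1
    rw [← h1]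
    refine integral_congr_ae ?_
    filter_upwards [hΦ (c i), hΦ (c j)] with y hi hj
    rw [← hi, ← hj, hc, hc]
    simp [mul_comm]
  · have h1 : u j ∈ Submodule.span ℝ (range e) := hspan ▸ Submodule.subset_span (mem_range_self j)
    obtain ⟨d, hd⟩ := (Submodule.mem_span_range_iff_exists_fun ℝ).1 h1
    refine ⟨d, fun y => ?_⟩
    -- Injectivity of `Φ` turns an almost everywhere identity into one between coefficients, hence
    -- into an identity at every point.
    have h2 : Φ (∑ i, d i • c i) = Φ (Pi.single j 1) := by
      rw [map_sum]
      simp_rw [map_smul, hc]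
      exact hd
    have h3 := LinearMap.ker_eq_bot.1 hker h2
    have h4 := congrArg (fun c => P c y) h3
    simp only [map_sum, map_smul, Finset.sum_apply, Pi.smul_apply, smul_eq_mul] at h4
    rw [h4, hPapp]
    simp [Pi.single_apply]

end

section
variable {M : Type*} [MetricSpace M] [MeasurableSpace M] [BorelSpace M] {μ : Measure M}

/-- A bounded function on a ball can be corrected by a function whose size is controlled by its mean
so as to become orthogonal to the functions in the Taylor formula. -/
theorem exists_correction (hv : HasContinuousVolume μ) {m : ℕ} {p : Fin m → M → ℝ} {x₀ : M} {r : ℝ}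
    (hr : 0 < vol μ x₀ r) (hpm : ∀ j, Measurable (p j))
    (hpb : ∀ j, ∃ K : ℝ, ∀ y ∈ closedBall x₀ r, |p j y| ≤ K)
    (hli : ∀ c : Fin m → ℝ,
      (∀ᵐ y ∂μ.restrict (closedBall x₀ r), ∑ j, c j * p j y = 0) → c = 0) {C : ℝ}
    (hC : ∀ v : Fin m → M → ℝ, (∀ j, v j ∈ Submodule.span ℝ (range p)) →
      (∀ i j, ∫ y in closedBall x₀ r, v i y * v j y ∂μ = if i = j then 1 else 0) →
      ∀ j, ∀ y ∈ closedBall x₀ r, |v j y| ≤ C / √(vol μ x₀ r))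
    {f : M → ℝ} (hf : Measurable f) {D : ℝ} (hfb : ∀ y, |f y| ≤ D) {I : ℝ}
    (hI : ∫ y in closedBall x₀ r, |f y| ∂μ ≤ I) :
    ∃ b : M → ℝ, Measurable b ∧
      (∀ y ∈ closedBall x₀ r, |b y| ≤ m * C ^ 2 * (I / vol μ x₀ r)) ∧
      ∀ j, ∫ y in closedBall x₀ r, p j y * (f y - b y) ∂μ = 0 := by
  set F := closedBall x₀ r with hFdef
  have hF : MeasurableSet F := isClosed_closedBall.measurableSet
  have : IsFiniteMeasure (μ.restrict F) := ⟨by simpa using hv.finite x₀ r⟩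
  have hmem : ∀ j, MemLp (p j) 2 (μ.restrict F) := by
    intro j
    obtain ⟨K, hK⟩ := hpb j
    refine MemLp.of_bound (hpm j).aestronglyMeasurable K ?_
    filter_upwards [ae_restrict_mem hF] with y hy using hK y hy
  obtain ⟨v, hvs, hvo, hvp⟩ := exists_orthonormal_combinations hmem hli
  have hvb := hC v hvs hvo
  have hvm : ∀ j, Measurable (v j) := by
    intro j
    obtain ⟨c, hc⟩ := (Submodule.mem_span_range_iff_exists_fun ℝ).1 (hvs j)
    have hc' : v j = fun y => ∑ i, c i * p i y := by
      ext y
      simp [← hc, Finset.sum_apply]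
    rw [hc']
    exact Finset.measurable_fun_sum _ fun i _ => (hpm i).const_mul (c i)
  have hfi : Integrable f (μ.restrict F) :=
    Integrable.of_bound hf.aestronglyMeasurable D (Filter.Eventually.of_forall hfb)
  have hvi : ∀ j, Integrable (v j) (μ.restrict F) := by
    intro j
    refine Integrable.of_bound (hvm j).aestronglyMeasurable (C / √(vol μ x₀ r)) ?_
    filter_upwards [ae_restrict_mem hF] with y hy using hvb j y hy
  have hfv : ∀ j, Integrable (fun y => v j y * f y) (μ.restrict F) := fun j =>
    (hvi j).mul_bdd (c := D) hf.aestronglyMeasurable (Filter.Eventually.of_forall hfb)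
  have hvv : ∀ i j, Integrable (fun y => v i y * v j y) (μ.restrict F) := by
    intro i j
    refine (hvi i).mul_bdd (c := C / √(vol μ x₀ r)) (hvm j).aestronglyMeasurable ?_
    filter_upwards [ae_restrict_mem hF] with y hy using hvb j y hy
  -- `b` is the orthogonal projection of `f`. Each coefficient and each basis function brings a
  -- factor `C V^{-1/2}`, whence `m C² I/V`; the bound `D` on `f` serves only integrability.
  set a : Fin m → ℝ := fun i => ∫ y in F, v i y * f y ∂μ with ha
  have hab : ∀ i, |a i| ≤ C / √(vol μ x₀ r) * I := by
    intro i
    have hpos : 0 ≤ C / √(vol μ x₀ r) := by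
      have hne : F.Nonempty := by
        by_contra h
        rw [not_nonempty_iff_eq_empty] at h
        rw [vol, ← hFdef, h] at hr
        simp at hr
      obtain ⟨y, hy⟩ := hne
      exact (abs_nonneg _).trans (hvb i y hy)
    calc |a i| ≤ ∫ y in F, |v i y * f y| ∂μ := abs_integral_le_integral_abs
      _ ≤ ∫ y in F, C / √(vol μ x₀ r) * |f y| ∂μ := by
          refine setIntegral_mono_on (hfv i).abs (hfi.abs.const_mul _) hF fun y hy => ?_
          rw [abs_mul]
          exact mul_le_mul_of_nonneg_right (hvb i y hy) (abs_nonneg _)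
      _ ≤ _ := by
          rw [integral_const_mul]
          exact mul_le_mul_of_nonneg_left hI hpos
  refine ⟨fun y => ∑ i, a i * v i y, ?_, ?_, ?_⟩
  · exact Finset.measurable_fun_sum _ fun i _ => (hvm i).const_mul _
  · intro y hy
    have h1 : ∀ i, |a i * v i y| ≤ C ^ 2 * (I / vol μ x₀ r) := by
      intro i
      rw [abs_mul]
      refine (mul_le_mul (hab i) (hvb i y hy) (abs_nonneg _)
        ((abs_nonneg _).trans (hab i))).trans_eq ?_
      have := Real.sq_sqrt hr.le
      have h2 : √(vol μ x₀ r) ≠ 0 := (Real.sqrt_pos.2 hr).ne'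
      rw [← this]
      field_simp
      simp [this]
    refine (Finset.abs_sum_le_sum_abs _ _).trans ((Finset.sum_le_sum fun i _ => h1 i).trans_eq ?_)
    simp [mul_assoc]
  · intro j
    obtain ⟨d, hd⟩ := hvp j
    have hbi : Integrable (fun y => ∑ i, a i * v i y) (μ.restrict F) :=
      integrable_finsetSum _ fun i _ => (hvi i).const_mul _
    have h0 : ∀ i, ∫ y in F, v i y * (f y - ∑ l, a l * v l y) ∂μ = 0 := by
      intro i
      have e1 : ∀ y, v i y * (f y - ∑ l, a l * v l y) =
          v i y * f y - ∑ l, a l * (v i y * v l y) := by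
        intro y
        rw [mul_sub, Finset.mul_sum]
        congr 1
        exact Finset.sum_congr rfl fun l _ => by ring
      simp_rw [e1]
      rw [integral_sub (hfv i) (integrable_finsetSum _ fun l _ => (hvv i l).const_mul _),
        integral_finsetSum _ fun l _ => (hvv i l).const_mul _]
      simp_rw [integral_const_mul, hvo]
      simp [ha]
    have e2 : ∀ y, p j y * (f y - ∑ l, a l * v l y) =
        ∑ i, d i * (v i y * (f y - ∑ l, a l * v l y)) := by
      intro y
      rw [hd, Finset.sum_mul]
      exact Finset.sum_congr rfl fun i _ => by ring
    simp_rw [e2]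
    rw [integral_finsetSum]
    · simp_rw [integral_const_mul, h0]
      simp
    · intro i _
      refine Integrable.const_mul ?_ _
      refine (hfi.sub hbi).bdd_mul (c := C / √(vol μ x₀ r)) (hvm i).aestronglyMeasurable ?_
      filter_upwards [ae_restrict_mem hF] with y hy using hvb i y hy

end

/-! ### Integrability of potentials of cancelling functions -/

theorem abs_integral_le_of_lintegral_enorm_le {α : Type*} [MeasurableSpace α] {μ : Measure α}
    {g : α → ℝ} {C : ℝ} (hC : 0 ≤ C) (h : ∫⁻ y, ‖g y‖ₑ ∂μ ≤ ENNReal.ofReal C) :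
    |∫ y, g y ∂μ| ≤ C := by
  have h1 := (enorm_integral_le_lintegral_enorm g).trans h
  rw [← ofReal_norm, Real.norm_eq_abs] at h1
  exact (ENNReal.ofReal_le_ofReal_iff hC).1 h1

theorem normPow_eq_lintegral {α : Type*} [MeasurableSpace α] (μ : Measure α)
    {q : ℝ} (hq : 0 < q) (g : α → ℝ) : normPow μ q g = ∫⁻ x, ‖g x‖ₑ ^ q ∂μ := by
  rw [normPow, eLpNorm_eq_lintegral_rpow_enorm_toReal (by simpa using hq) ENNReal.ofReal_ne_top,
    ENNReal.toReal_ofReal hq.le, ← ENNReal.rpow_mul, one_div_mul_cancel hq.ne', ENNReal.rpow_one]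

theorem lintegral_kernel_le {α : Type*} [MeasurableSpace α] {μ : Measure α} {k : α → α → ℝ}
    {β β' K : ℝ} (hβ : β.HolderConjugate β') (hK : 0 ≤ K) (hkm : Measurable (Function.uncurry k))
    {x : α} (hw : WeakOne μ (fun y => |k x y| ^ β) K)
    {F : Set α} {ρ : ℝ} (hρ : 0 < ρ) (hF : μ F ≤ ENNReal.ofReal ρ) :
    ∫⁻ y in F, ‖k x y‖ₑ ∂μ ≤
      ENNReal.ofReal ((1 + K * (1 / β) / (1 - 1 / β)) * ρ ^ (1 / β')) := by
  have h1 : 1 - 1 / β = 1 / β' := by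
    have := hβ.inv_add_inv_eq_one
    simp only [one_div]
    linarith
  have hkx : Measurable (k x) := hkm.of_uncurry_left
  have := hw.setLIntegral_rpow_le hK (hkx.abs.pow_const β) (fun y => by positivity)
    (a := 1 / β) (one_div_nonneg.2 hβ.nonneg) ((div_lt_one hβ.pos).2 hβ.lt) hρ hF
  rw [← h1]
  refine le_trans (le_of_eq ?_) this
  refine lintegral_congr fun y => ?_
  rw [← Real.rpow_mul (abs_nonneg _), mul_one_div_cancel hβ.ne_zero, Real.rpow_one, ← ofReal_norm,
    Real.norm_eq_abs]

section
variable {M : Type*} [MetricSpace M] [MeasurableSpace M] [BorelSpace M] {μ : Measure M}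

theorem lintegral_enorm_le_of_le_invVol (hv : HasContinuousVolume μ) {β β' D : ℝ}
    (hβ : β.HolderConjugate β') (hD : 0 ≤ D) {x₀ : M} {r : ℝ} (hr : 0 < vol μ x₀ r) {f : M → ℝ}
    (hfb : ∀ᵐ y ∂μ, |f y| ≤ D * invVol μ x₀ y ^ (1 / β')) :
    ∫⁻ y in closedBall x₀ r, ‖f y‖ₑ ∂μ ≤
      ENNReal.ofReal (D * (1 + 1 * (1 / β') / (1 - 1 / β')) * vol μ x₀ r ^ (1 / β)) := by
  have h1 : 1 - 1 / β' = 1 / β := by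
    have := hβ.inv_add_inv_eq_one
    simp only [one_div]
    linarith
  calc _ ≤ ∫⁻ y in closedBall x₀ r, ENNReal.ofReal D *
        ENNReal.ofReal (invVol μ x₀ y ^ (1 / β')) ∂μ := by
        refine lintegral_mono_ae ?_
        filter_upwards [ae_restrict_of_ae hfb] with y hy
        rw [← ENNReal.ofReal_mul hD, ← ofReal_norm]
        exact ENNReal.ofReal_le_ofReal hy
    _ ≤ _ := by
        rw [lintegral_const_mul' _ _ ENNReal.ofReal_ne_top, mul_assoc D, ENNReal.ofReal_mul hD]
        gcongr
        have := (hv.weakOne_invVol x₀).setLIntegral_rpow_le zero_le_one (hv.measurable_invVol x₀)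
          (invVol_nonneg x₀) (a := 1 / β') (one_div_nonneg.2 hβ.symm.nonneg)
          ((div_lt_one hβ.symm.pos).2 hβ.symm.lt) hr (F := closedBall x₀ r) (hv.ofReal_vol x₀ r).ge
        rwa [h1] at this ⊢

/-- Potentials of functions which are dominated by a power of the volume and have vanishing
moments are in `L^q`. -/
theorem lintegral_potential_rpow_le (hv : HasContinuousVolume μ) {k : M → M → ℝ}
    (hkm : Measurable (Function.uncurry k)) {β β' K : ℝ} (hβ : β.HolderConjugate β')
    (hw₁ : ∀ x, WeakOne μ (fun y => |k x y| ^ β) K)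
    (hw₂ : ∀ y, WeakOne μ (fun x => |k x y| ^ β) K) {x₀ : M} {η : ℝ} (hη : 0 ≤ η) {m : ℕ}
    {κ p : Fin m → M → ℝ} (hpm : ∀ j, Measurable (p j))
    (hpb : ∀ r > 0, ∀ j, ∃ K : ℝ, ∀ y ∈ closedBall x₀ r, |p j y| ≤ K) {C₀ : ℝ}
    (hT : ∀ r > 0, ∀ R > 0, (1 + 1) * vol μ x₀ r ≤ vol μ x₀ R →
      ∀ x y, dist y x₀ ≤ r → R ≤ dist x x₀ → 0 < vol μ x₀ (dist x x₀) →
        |k x y - ∑ j, κ j x * p j y| ≤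
          C₀ * vol μ x₀ (dist y x₀) ^ η * vol μ x₀ (dist x x₀) ^ (-η - 1 / β))
    {D q : ℝ} (hD : 0 ≤ D) (hq : 0 < q) (hqη : 1 < (η + 1 / β) * q) :
    ∃ C ≥ 0, ∀ r, 0 < vol μ x₀ r → ∀ f : M → ℝ, Measurable f →
      Function.support f ⊆ closedBall x₀ r →
      (∀ᵐ y ∂μ, |f y| ≤ D * invVol μ x₀ y ^ (1 / β')) → (∀ j, ∫ y, p j y * f y ∂μ = 0) →
      normPow μ q (potential μ k f) ≤ ENNReal.ofReal (C * vol μ x₀ r) := by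
  have : Nonempty M := ⟨x₀⟩
  have : SigmaFinite μ := hv.sigmaFinite
  have hβ0 := hβ.pos
  have hβ0' := hβ.symm.pos
  have hK1 : (0 : ℝ) ≤ max K 1 := zero_le_one.trans (le_max_right _ _)
  have hmono : ∀ {h : M → ℝ} {K₁ K₂ : ℝ}, K₁ ≤ K₂ → WeakOne μ h K₁ → WeakOne μ h K₂ :=
    fun hle hw s hs => (hw s hs).trans (ENNReal.ofReal_le_ofReal (by gcongr))
  -- `max K 1` is a common weak constant for the kernel and for `invVol`, whose own constant is `1`.
  obtain ⟨C₁, hC₁, hnear⟩ := lintegral_mixed_rpow_le (μ := μ) (H := fun x y => |k x y| ^ β)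
    (h := invVol μ x₀) (K := max K 1) (hkm.abs.pow_const β) (fun x y => by positivity)
    (fun x => hmono (le_max_left _ _) (hw₁ x)) (fun y => hmono (le_max_left _ _) (hw₂ y))
    (hv.measurable_invVol x₀) (invVol_nonneg x₀) (hmono (le_max_right _ _) (hv.weakOne_invVol x₀))
    hK1 hβ hq.le
  set c₁ : ℝ := D * (1 + 1 * (1 / β') / (1 - 1 / β')) with hc₁
  have hc₁0 : 0 ≤ c₁ := by
    have h1 : 0 < 1 - 1 / β' := sub_pos.2 ((div_lt_one hβ0').2 hβ.symm.lt)
    positivity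
  -- `b` is the power of `1/V` in the far bound for `|Tf|^q`; its integral over `V ≥ 2ρ` is
  -- `O(ρ^{1-b})` because `b > 1`.
  set b : ℝ := (η + 1 / β) * q with hb
  have hb1 : 0 < b - 1 := by linarith
  set c₂ : ℝ := |C₀| * c₁ with hc₂
  have hc₂0 : 0 ≤ c₂ := by positivity
  refine ⟨D ^ q * C₁ + c₂ ^ q * (1 * b / (b - 1) * (2 : ℝ) ^ (-(b - 1))), by positivity, ?_⟩
  intro r hr f hf hsupp hfb hmom
  set ρ := vol μ x₀ r with hρ
  have hr0 : 0 < r := hv.pos_of_vol_pos hr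
  set F := closedBall x₀ r with hFd
  have hF : MeasurableSet F := isClosed_closedBall.measurableSet
  have hμF : μ F = ENNReal.ofReal ρ := (hv.ofReal_vol x₀ r).symm
  -- The factor `2` is `1 + δ` with `δ = 1`, so the Taylor remainder estimate is available on all of
  -- `Eᶜ`.
  set E := {x | vol μ x₀ (dist x₀ x) < 2 * ρ} with hEd
  have hE : MeasurableSet E := measurableSet_lt (hv.measurable_vol_dist x₀) measurable_const
  have hμE : μ E ≤ ENNReal.ofReal (2 * ρ) :=
    (measure_mono (t := {x | vol μ x₀ (dist x₀ x) ≤ 2 * ρ}) fun x hx =>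
      (show vol μ x₀ (dist x₀ x) < 2 * ρ from hx).le).trans
        (hv.measure_vol_dist_le x₀ (by positivity))
  have hf1 := lintegral_enorm_le_of_le_invVol hv hβ hD hr hfb
  have hout : ∀ g : M → ℝ, ∀ y ∉ F, g y * f y = 0 := by
    intro g y hy
    rw [Function.notMem_support.1 fun h => hy (hsupp h), mul_zero]
  have hrest : ∀ g : M → ℝ, ∫ y, g y * f y ∂μ = ∫ y in F, g y * f y ∂μ := fun g =>
    (setIntegral_eq_integral_of_forall_compl_eq_zero (hout g)).symm
  have hfi : Integrable f (μ.restrict F) :=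
    ⟨hf.aestronglyMeasurable, hf1.trans_lt ENNReal.ofReal_lt_top⟩
  rw [normPow_eq_lintegral μ hq, ← lintegral_add_compl _ hE, add_mul,
    ENNReal.ofReal_add (by positivity) (by positivity)]
  refine add_le_add ?_ ?_
  · calc _ ≤ ∫⁻ x in E, (ENNReal.ofReal D * ∫⁻ y in F,
          ENNReal.ofReal ((|k x y| ^ β) ^ (1 / β) * invVol μ x₀ y ^ (1 / β')) ∂μ) ^ q ∂μ := by
          refine lintegral_mono fun x => ENNReal.rpow_le_rpow ?_ hq.le
          rw [potential, hrest, ← lintegral_const_mul' _ _ ENNReal.ofReal_ne_top]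
          refine (enorm_integral_le_lintegral_enorm _).trans (lintegral_mono_ae ?_)
          filter_upwards [ae_restrict_of_ae hfb] with y hy
          rw [← ENNReal.ofReal_mul hD, ← ofReal_norm, ← Real.rpow_mul (abs_nonneg _),
            mul_one_div_cancel hβ.ne_zero, Real.rpow_one, Real.norm_eq_abs, abs_mul]
          refine ENNReal.ofReal_le_ofReal ?_
          calc |k x y| * |f y| ≤ |k x y| * (D * invVol μ x₀ y ^ (1 / β')) := by gcongr
            _ = _ := by ring
      _ = ENNReal.ofReal D ^ q * ∫⁻ x in E, (∫⁻ y in F,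
          ENNReal.ofReal ((|k x y| ^ β) ^ (1 / β) * invVol μ x₀ y ^ (1 / β')) ∂μ) ^ q ∂μ := by
          simp_rw [ENNReal.mul_rpow_of_nonneg _ _ hq.le]
          rw [lintegral_const_mul' _ _ (ENNReal.rpow_ne_top_of_nonneg hq.le ENNReal.ofReal_ne_top)]
      _ ≤ ENNReal.ofReal (D ^ q) * ENNReal.ofReal (C₁ * ρ) := by
          rw [ENNReal.ofReal_rpow_of_nonneg hD hq.le]
          gcongr
          exact hnear ρ hr E F hμE hμF.le
      _ = _ := by rw [← ENNReal.ofReal_mul (by positivity), mul_assoc]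
  · have hfar : ∀ x ∈ Eᶜ, ‖potential μ k f x‖ₑ ^ q ≤
        ENNReal.ofReal (c₂ ^ q * ρ ^ b) * ENNReal.ofReal (invVol μ x₀ x ^ b) := by
      intro x hx
      have hx2 : 2 * ρ ≤ vol μ x₀ (dist x₀ x) := not_lt.1 hx
      have hxpos : 0 < vol μ x₀ (dist x₀ x) := by linarith
      have hdist := hv.pos_of_vol_pos hxpos
      have hrem : ∀ y ∈ F, |k x y - ∑ j, κ j x * p j y| ≤
          |C₀| * ρ ^ η * invVol μ x₀ x ^ (η + 1 / β) := by
        intro y hy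
        have hy' : dist y x₀ ≤ r := hy
        have h1 := hT r hr0 (dist x₀ x) hdist (by rw [← hρ]; linarith) x y hy'
          (dist_comm x₀ x).le (by rwa [dist_comm])
        rw [dist_comm x x₀] at h1
        refine h1.trans ?_
        rw [invVol, Real.inv_rpow hxpos.le, ← Real.rpow_neg hxpos.le,
          show -η - 1 / β = -(η + 1 / β) by ring]
        have h2 : vol μ x₀ (dist y x₀) ^ η ≤ ρ ^ η :=
          Real.rpow_le_rpow (vol_nonneg _ _) (hv.vol_mono x₀ hy') hη
        have h3 := vol_nonneg (μ := μ) x₀ (dist y x₀)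
        gcongr
        exact le_abs_self _
      have hpi : ∀ j, Integrable (fun y => κ j x * (p j y * f y)) (μ.restrict F) := by
        intro j
        obtain ⟨Kj, hKj⟩ := hpb r hr0 j
        refine Integrable.const_mul ?_ _
        refine hfi.bdd_mul (c := Kj) (hpm j).aestronglyMeasurable ?_
        filter_upwards [ae_restrict_mem hF] with y hy using hKj y hy
      have hkx : Measurable (k x) := hkm.of_uncurry_left
      have hdi : Integrable (fun y => (k x y - ∑ j, κ j x * p j y) * f y) (μ.restrict F) := by
        refine hfi.bdd_mul (c := |C₀| * ρ ^ η * invVol μ x₀ x ^ (η + 1 / β)) ?_ ?_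
        · exact (hkx.sub (Finset.measurable_fun_sum _ fun j _ =>
            (hpm j).const_mul _)).aestronglyMeasurable
        · filter_upwards [ae_restrict_mem hF] with y hy using hrem y hy
      -- The vanishing moments allow the Taylor sum to be subtracted from the kernel, leaving only
      -- the decaying remainder.
      have hpot : potential μ k f x = ∫ y in F, (k x y - ∑ j, κ j x * p j y) * f y ∂μ := by
        rw [potential, hrest]
        have e1 : ∀ y, k x y * f y = (k x y - ∑ j, κ j x * p j y) * f y +
            ∑ j, κ j x * (p j y * f y) := by
          intro y
          rw [sub_mul, Finset.sum_mul]
          simp_rw [mul_assoc]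
          ring
        simp_rw [e1]
        rw [integral_add hdi (integrable_finsetSum _ fun j _ => hpi j),
          integral_finsetSum _ fun j _ => hpi j]
        simp_rw [integral_const_mul, ← hrest, hmom]
        simp
      have h4 : ‖potential μ k f x‖ₑ ≤
          ENNReal.ofReal (c₂ * (ρ ^ (η + 1 / β) * invVol μ x₀ x ^ (η + 1 / β))) := by
        rw [hpot]
        calc _ ≤ ∫⁻ y in F, ‖(k x y - ∑ j, κ j x * p j y) * f y‖ₑ ∂μ :=
              enorm_integral_le_lintegral_enorm _
          _ ≤ ∫⁻ y in F, ENNReal.ofReal (|C₀| * ρ ^ η * invVol μ x₀ x ^ (η + 1 / β)) *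
                ‖f y‖ₑ ∂μ := by
              refine setLIntegral_mono' hF fun y hy => ?_
              rw [enorm_mul, ← ofReal_norm (k x y - _)]
              gcongr
              exact hrem y hy
          _ ≤ ENNReal.ofReal (|C₀| * ρ ^ η * invVol μ x₀ x ^ (η + 1 / β)) *
                ENNReal.ofReal (c₁ * ρ ^ (1 / β)) := by
              rw [lintegral_const_mul' _ _ ENNReal.ofReal_ne_top]
              gcongr
          _ = _ := by
              have := invVol_nonneg (μ := μ) x₀ x
              rw [← ENNReal.ofReal_mul (by positivity), hc₂, Real.rpow_add hr]
              congr 1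
              ring
      refine (ENNReal.rpow_le_rpow h4 hq.le).trans_eq ?_
      have h5 := invVol_nonneg (μ := μ) x₀ x
      rw [ENNReal.ofReal_rpow_of_nonneg (by positivity) hq.le, ← ENNReal.ofReal_mul (by positivity),
        Real.mul_rpow hc₂0 (by positivity),
        Real.mul_rpow (x := ρ ^ (η + 1 / β)) (by positivity) (by positivity),
        ← Real.rpow_mul hr.le, ← Real.rpow_mul h5, mul_assoc]
    calc _ ≤ ∫⁻ x in Eᶜ, ENNReal.ofReal (c₂ ^ q * ρ ^ b) *
          ENNReal.ofReal (invVol μ x₀ x ^ b) ∂μ := setLIntegral_mono' hE.compl hfar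
      _ ≤ ENNReal.ofReal (c₂ ^ q * ρ ^ b) *
          ENNReal.ofReal (1 * b / (b - 1) * ((2 * ρ)⁻¹) ^ (b - 1)) := by
          rw [lintegral_const_mul' _ _ ENNReal.ofReal_ne_top]
          gcongr
          refine le_trans (lintegral_mono_set fun x hx => ?_)
            ((hv.weakOne_invVol x₀).setLIntegral_rpow_le_of_le zero_le_one
              (hv.measurable_invVol x₀) (invVol_nonneg x₀) hqη (T := (2 * ρ)⁻¹) (by positivity))
          have hx2 : 2 * ρ ≤ vol μ x₀ (dist x₀ x) := not_lt.1 hx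
          exact inv_anti₀ (by positivity) hx2
      _ = _ := by
          rw [← ENNReal.ofReal_mul (by positivity)]
          congr 1
          rw [Real.inv_rpow (by positivity), ← Real.rpow_neg (by positivity),
            Real.mul_rpow (by norm_num) hr.le]
          have h6 : ρ ^ b * ρ ^ (-(b - 1)) = ρ := by
            rw [← Real.rpow_add hr, show b + -(b - 1) = 1 by ring, Real.rpow_one]
          linear_combination (c₂ ^ q * (1 * b / (b - 1) * 2 ^ (-(b - 1)))) * h6

end

/-! ### The extremal functions -/

/-- Bernoulli's inequality for `x/(x+y)`. What matters is the coefficient `1` of `|a|^s`: a larger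
one would spoil the sharp exponential constant. -/
theorem rpow_abs_sub_le {s : ℝ} (hs : 1 ≤ s) (a b : ℝ) :
    |a - b| ^ s ≤ |a| ^ s + s * 2 ^ (s - 1) * (|b| * |a| ^ (s - 1) + |b| ^ s) := by
  have hs0 : 0 ≤ s - 1 := by linarith
  set x := |a|
  set y := |b|
  have hx : 0 ≤ x := abs_nonneg a
  have hy : 0 ≤ y := abs_nonneg b
  have h1 : |a - b| ^ s ≤ (x + y) ^ s :=
    Real.rpow_le_rpow (abs_nonneg _) (abs_sub a b) (by linarith)
  refine h1.trans ?_
  rcases (add_nonneg hx hy).eq_or_lt with h | h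
  · rw [← h, Real.zero_rpow (by linarith)]
    positivity
  have h2 : (x + y) ^ s ≤ x ^ s + s * y * (x + y) ^ (s - 1) := by
    have h3 := one_add_mul_self_le_rpow_one_add (s := -(y / (x + y)))
      (by rw [neg_le_neg_iff, div_le_one h]; linarith) hs
    have h4 : 1 + -(y / (x + y)) = x / (x + y) := by field_simp; ring
    rw [h4, Real.div_rpow hx h.le] at h3
    have h5 : 0 < (x + y) ^ s := by positivity
    have h6 : (x + y) ^ s = (x + y) ^ (s - 1) * (x + y) := by
      rw [← Real.rpow_add_one h.ne', sub_add_cancel]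
    rw [le_div_iff₀ h5] at h3
    have h7 : (y / (x + y)) * (x + y) ^ s = y * (x + y) ^ (s - 1) := by
      rw [h6]; field_simp
    nlinarith
  have h8 : (x + y) ^ (s - 1) ≤ 2 ^ (s - 1) * (x ^ (s - 1) + y ^ (s - 1)) := by
    rcases le_total x y with hxy | hxy
    · calc (x + y) ^ (s - 1) ≤ (2 * y) ^ (s - 1) :=
          Real.rpow_le_rpow h.le (by linarith) hs0
        _ = 2 ^ (s - 1) * y ^ (s - 1) := Real.mul_rpow (by norm_num) hy
        _ ≤ _ := by gcongr; linarith [Real.rpow_nonneg hx (s - 1)]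
    · calc (x + y) ^ (s - 1) ≤ (2 * x) ^ (s - 1) :=
          Real.rpow_le_rpow h.le (by linarith) hs0
        _ = 2 ^ (s - 1) * x ^ (s - 1) := Real.mul_rpow (by norm_num) hx
        _ ≤ _ := by gcongr; linarith [Real.rpow_nonneg hy (s - 1)]
  have h9 : y * y ^ (s - 1) = y ^ s := by
    rcases hy.eq_or_lt with hy0 | hy0
    · rw [← hy0, Real.zero_rpow (by linarith : s ≠ 0), zero_mul]
    · rw [mul_comm, ← Real.rpow_add_one hy0.ne', sub_add_cancel]
  calc (x + y) ^ s ≤ x ^ s + s * y * (x + y) ^ (s - 1) := h2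
    _ ≤ x ^ s + s * y * (2 ^ (s - 1) * (x ^ (s - 1) + y ^ (s - 1))) := by gcongr
    _ = x ^ s + s * 2 ^ (s - 1) * (y * x ^ (s - 1) + y * y ^ (s - 1)) := by ring
    _ = _ := by rw [h9]

section
variable {M : Type*} [MetricSpace M] [MeasurableSpace M] {μ : Measure M}

/-- The density `sgn(k(x,y)) |k(x,y)|^{β-1}` on an annulus around `x`. -/
def dualDensity (k : M → M → ℝ) (β : ℝ) (x : M) (r₁ r₂ : ℝ) : M → ℝ :=
  indicator {y | r₁ ≤ dist x y ∧ dist x y ≤ r₂} fun y => k x y * |k x y| ^ (β - 2)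

theorem abs_mul_abs_rpow_sub_two {β : ℝ} (hβ : 1 < β) (t : ℝ) :
    |t * |t| ^ (β - 2)| = |t| ^ (β - 1) := by
  rcases eq_or_ne t 0 with rfl | ht
  · simp [Real.zero_rpow (by linarith : β - 1 ≠ 0)]
  · have h : 0 < |t| := abs_pos.2 ht
    rw [abs_mul, abs_of_pos (Real.rpow_pos_of_pos h _), mul_comm, ← Real.rpow_add_one h.ne']
    congr 1
    ring

theorem mul_self_mul_abs_rpow_sub_two {β : ℝ} (hβ : 1 < β) (t : ℝ) :
    t * (t * |t| ^ (β - 2)) = |t| ^ β := by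
  rcases eq_or_ne t 0 with rfl | ht
  · simp [Real.zero_rpow (by linarith : β ≠ 0)]
  · have h : 0 < |t| := abs_pos.2 ht
    rw [← mul_assoc, ← abs_mul_abs_self t, mul_assoc, mul_comm |t| (_ ^ _),
      ← Real.rpow_add_one h.ne', mul_comm, ← Real.rpow_add_one h.ne']
    congr 1
    ring

theorem abs_dualDensity_le {k : M → M → ℝ} {β β' B : ℝ} (hβ : β.HolderConjugate β') (hB : 0 ≤ B)
    (hv : HasContinuousVolume μ) {x : M} {r₁ r₂ : ℝ} (hr₁ : 0 < vol μ x r₁)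
    (hb : ∀ y, r₁ ≤ dist x y → dist x y ≤ r₂ → |k x y| ≤ B * vol μ x (dist x y) ^ (-(1 / β)))
    (y : M) : |dualDensity k β x r₁ r₂ y| ≤ B ^ (β - 1) * invVol μ x y ^ (1 / β') := by
  have h0 : 0 ≤ invVol μ x y := invVol_nonneg x y
  rw [dualDensity]
  by_cases hy : y ∈ {y | r₁ ≤ dist x y ∧ dist x y ≤ r₂}
  · rw [indicator_of_mem hy, abs_mul_abs_rpow_sub_two hβ.lt]
    have hpos : 0 < vol μ x (dist x y) := hr₁.trans_le (hv.vol_mono x hy.1)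
    refine (Real.rpow_le_rpow (abs_nonneg _) (hb y hy.1 hy.2)
      (by linarith [hβ.lt] : 0 ≤ β - 1)).trans_eq ?_
    rw [Real.mul_rpow hB (by positivity), ← Real.rpow_mul hpos.le, invVol, Real.inv_rpow hpos.le,
      ← Real.rpow_neg hpos.le]
    congr 2
    have h1 := hβ.inv_add_inv_eq_one
    have h2 := hβ.ne_zero
    simp only [one_div]
    have h3 : β'⁻¹ = 1 - β⁻¹ := by linarith
    rw [h3]
    field_simp
  · rw [indicator_of_notMem hy, abs_zero]
    positivity

/-- This bound depends on `r₁` and is used only for integrability; the uniform constants come from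
`abs_dualDensity_le`. -/
theorem abs_dualDensity_le_const {k : M → M → ℝ} {β β' B : ℝ} (hβ : β.HolderConjugate β')
    (hB : 0 ≤ B) (hv : HasContinuousVolume μ) {x : M} {r₁ r₂ : ℝ} (hr₁ : 0 < vol μ x r₁)
    (hb : ∀ y, r₁ ≤ dist x y → dist x y ≤ r₂ → |k x y| ≤ B * vol μ x (dist x y) ^ (-(1 / β)))
    (y : M) : |dualDensity k β x r₁ r₂ y| ≤ B ^ (β - 1) * ((vol μ x r₁)⁻¹) ^ (1 / β') := by
  by_cases hy : y ∈ {y | r₁ ≤ dist x y ∧ dist x y ≤ r₂}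
  · refine (abs_dualDensity_le hβ hB hv hr₁ hb y).trans ?_
    have h0 : 0 ≤ invVol μ x y := invVol_nonneg x y
    have : 0 ≤ 1 / β' := one_div_nonneg.2 hβ.symm.nonneg
    gcongr
    exact inv_anti₀ hr₁ (hv.vol_mono x hy.1)
  · rw [dualDensity, indicator_of_notMem hy, abs_zero]
    positivity

variable [BorelSpace M]

theorem measurableSet_annulus (x : M) (r₁ r₂ : ℝ) :
    MeasurableSet {y | r₁ ≤ dist x y ∧ dist x y ≤ r₂} :=
  (isClosed_le continuous_const (continuous_const.dist continuous_id)).measurableSet.inter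
    (isClosed_le (continuous_const.dist continuous_id) continuous_const).measurableSet

theorem measurable_dualDensity {k : M → M → ℝ} (hkm : Measurable (Function.uncurry k)) (β : ℝ)
    (x : M) (r₁ r₂ : ℝ) : Measurable (dualDensity k β x r₁ r₂) := by
  have hkx : Measurable (k x) := hkm.of_uncurry_left
  exact (hkx.mul (hkx.abs.pow_const _)).indicator (measurableSet_annulus x r₁ r₂)

end

section
variable {M : Type*} [MetricSpace M] [MeasurableSpace M] [BorelSpace M] {μ : Measure M}

/-- The correction costs `O(1)` at every scale: the cross term is `ρ^{-1/β'} ∫ V^{-1/β} = O(1)`,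
since the integral over the ball is `O(ρ^{1/β'})`, and `|b|^{β'} = O(1/ρ)` on a ball of volume `ρ`.
-/
theorem lintegral_abs_sub_rpow_le (hv : HasContinuousVolume μ) {β β' D E : ℝ}
    (hβ : β.HolderConjugate β') (hD : 0 ≤ D) (hE : 0 ≤ E) {x₀ : M} {r : ℝ}
    (hr : 0 < vol μ x₀ r) {f b : M → ℝ} (hf : Measurable f)
    (hfb : ∀ y, |f y| ≤ D * invVol μ x₀ y ^ (1 / β'))
    (hb : ∀ y ∈ closedBall x₀ r, |b y| ≤ E * vol μ x₀ r ^ (-(1 / β'))) :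
    ∫⁻ y in closedBall x₀ r, ENNReal.ofReal (|f y - b y| ^ β') ∂μ ≤
      ∫⁻ y in closedBall x₀ r, ENNReal.ofReal (|f y| ^ β') ∂μ +
        ENNReal.ofReal (β' * 2 ^ (β' - 1) *
          (E * D ^ (β' - 1) * (1 + 1 * (1 / β) / (1 - 1 / β)) + E ^ β')) := by
  set ρ := vol μ x₀ r with hρ
  have hβ0' := hβ.symm.pos
  have hβ1' : 0 < β' - 1 := hβ.symm.sub_one_pos
  have hF : MeasurableSet (closedBall x₀ r) := isClosed_closedBall.measurableSet
  have hconj : 1 - 1 / β = 1 / β' := by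
    have := hβ.inv_add_inv_eq_one
    simp only [one_div]
    linarith
  have hconj' : 1 / β' * (β' - 1) = 1 / β := by
    rw [mul_sub, one_div_mul_cancel hβ0'.ne']; linarith
  set c := β' * 2 ^ (β' - 1) with hc
  have hc0 : 0 ≤ c := by positivity
  have h1 : ∀ y ∈ closedBall x₀ r, ENNReal.ofReal (|f y - b y| ^ β') ≤
      ENNReal.ofReal (|f y| ^ β') +
        (ENNReal.ofReal (c * (E * D ^ (β' - 1) * ρ ^ (-(1 / β')))) *
          ENNReal.ofReal (invVol μ x₀ y ^ (1 / β)) + ENNReal.ofReal (c * (E ^ β' * ρ⁻¹))) := by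
    intro y hy
    have h0 : 0 ≤ invVol μ x₀ y := invVol_nonneg x₀ y
    rw [← ENNReal.ofReal_mul (by positivity), ← ENNReal.ofReal_add (by positivity) (by positivity),
      ← ENNReal.ofReal_add (by positivity) (by positivity)]
    refine ENNReal.ofReal_le_ofReal ((rpow_abs_sub_le hβ.symm.lt.le _ _).trans ?_)
    have h2 : |f y| ^ (β' - 1) ≤ D ^ (β' - 1) * invVol μ x₀ y ^ (1 / β) := by
      refine (Real.rpow_le_rpow (abs_nonneg _) (hfb y) hβ1'.le).trans_eq ?_
      rw [Real.mul_rpow hD (by positivity), ← Real.rpow_mul h0, hconj']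
    have h3 : |b y| ^ β' ≤ E ^ β' * ρ⁻¹ := by
      refine (Real.rpow_le_rpow (abs_nonneg _) (hb y hy) hβ0'.le).trans_eq ?_
      rw [Real.mul_rpow hE (by positivity), ← Real.rpow_mul hr.le, neg_mul,
        one_div_mul_cancel hβ0'.ne', Real.rpow_neg_one]
    calc _ ≤ |f y| ^ β' + c * (E * ρ ^ (-(1 / β')) * (D ^ (β' - 1) * invVol μ x₀ y ^ (1 / β)) +
          E ^ β' * ρ⁻¹) := by
          gcongr
          exact hb y hy
      _ = _ := by ring
  refine (setLIntegral_mono' hF h1).trans ?_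
  rw [lintegral_add_left (hf.abs.pow_const _).ennreal_ofReal, lintegral_add_right _ measurable_const,
    lintegral_const_mul' _ _ ENNReal.ofReal_ne_top, lintegral_const, Measure.restrict_apply_univ,
    ← hv.ofReal_vol, ← hρ, mul_add c, ENNReal.ofReal_add (by
      have : 0 < 1 - 1 / β := by rw [hconj]; positivity
      have := hβ.pos
      positivity) (by positivity)]
  gcongr
  · have h4 := (hv.weakOne_invVol x₀).setLIntegral_rpow_le zero_le_one (hv.measurable_invVol x₀)
      (invVol_nonneg x₀) (a := 1 / β) (one_div_nonneg.2 hβ.nonneg)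
      ((div_lt_one hβ.pos).2 hβ.lt) hr (F := closedBall x₀ r) (hv.ofReal_vol x₀ r).ge
    refine (mul_le_mul_right h4 _).trans_eq ?_
    rw [← ENNReal.ofReal_mul (by positivity)]
    congr 1
    have h5 : ρ ^ (-(1 / β')) * ρ ^ (1 - 1 / β) = 1 := by
      rw [← Real.rpow_add hr, hconj, neg_add_cancel, Real.rpow_zero]
    linear_combination (c * (E * D ^ (β' - 1) * (1 + 1 * (1 / β) / (1 - 1 / β)))) * h5
  · rw [← ENNReal.ofReal_mul (by positivity)]
    refine (congrArg _ ?_).le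
    field_simp

/-- With `e = V(r₁)`, regularity turns the borderline integrand `V^{-1}` into `e^{η₁} V^{-1-η₁}`,
whose integral over `V ≥ e` is bounded independently of both radii. -/
theorem abs_integral_kernel_sub_le (hv : HasContinuousVolume μ) {k : M → M → ℝ} {β β' D : ℝ}
    (hβ : β.HolderConjugate β') (hD : 0 ≤ D) {x₀ : M} {η₁ C₁ : ℝ} (hη₁ : 0 < η₁)
    (hx : ∀ r > 0, ∀ R > 0, (1 + 1) * vol μ x₀ r ≤ vol μ x₀ R →
      ∀ x' ∈ closedBall x₀ r, ∀ y ∉ closedBall x₀ R, 0 < vol μ x₀ (dist x₀ y) →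
        |k x' y - k x₀ y| ≤
          C₁ * vol μ x₀ (dist x₀ x') ^ η₁ * vol μ x₀ (dist x₀ y) ^ (-η₁ - 1 / β))
    {r₁ s : ℝ} (hs : 0 < vol μ x₀ s) (hsr : 4 * vol μ x₀ s = vol μ x₀ r₁) {f : M → ℝ}
    (hfb : ∀ y, |f y| ≤ D * invVol μ x₀ y ^ (1 / β')) (hf0 : ∀ y, dist x₀ y < r₁ → f y = 0)
    {F : Set M} {x : M} (hxs : x ∈ closedBall x₀ s) :
    |∫ y in F, (k x y - k x₀ y) * f y ∂μ| ≤ |C₁| * D * (1 * (1 + η₁) / (1 + η₁ - 1)) := by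
  set e := vol μ x₀ r₁ with he
  have he0 : 0 < e := by linarith
  -- An intermediate volume `e/2`, twice that of the ball of radius `s`, is needed because
  -- regularity holds strictly outside `B(x₀,R)` while `f` may be nonzero on the sphere of radius
  -- `r₁`.
  obtain ⟨R, hR0, hR⟩ := hv.exists_vol_eq (x := x₀) (t := e / 2) (r := r₁) (by linarith)
    (by linarith)
  have hRr : R < r₁ := hv.lt_of_vol_lt (by linarith)
  set T := {y | invVol μ x₀ y ≤ e⁻¹} with hT
  have hTm : MeasurableSet T := measurableSet_le (hv.measurable_invVol x₀) measurable_const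
  have hc : 0 ≤ |C₁| * D := by positivity
  have h11 : 0 < 1 + η₁ - 1 := by linarith
  have hconj : -(η₁ + 1 / β) + -(1 / β') = -(1 + η₁) := by
    have := hβ.inv_add_inv_eq_one
    simp only [one_div]
    linarith
  refine abs_integral_le_of_lintegral_enorm_le (by positivity) ?_
  have hpt : ∀ y, ‖(k x y - k x₀ y) * f y‖ₑ ≤ T.indicator (fun y =>
      ENNReal.ofReal (|C₁| * D * e ^ η₁) * ENNReal.ofReal (invVol μ x₀ y ^ (1 + η₁))) y := by
    intro y
    by_cases hy : dist x₀ y < r₁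
    · simp [hf0 y hy]
    · rw [not_lt] at hy
      have hy1 : e ≤ vol μ x₀ (dist x₀ y) := hv.vol_mono x₀ hy
      have hy0 := he0.trans_le hy1
      have hyT : y ∈ T := inv_anti₀ he0 hy1
      rw [indicator_of_mem hyT, ← ENNReal.ofReal_mul (by positivity), ← ofReal_norm,
        Real.norm_eq_abs, abs_mul]
      refine ENNReal.ofReal_le_ofReal ?_
      have h1 := hx s (hv.pos_of_vol_pos hs) R hR0 (by linarith) x hxs y (by
        rw [mem_closedBall, dist_comm, not_le]; linarith) hy0
      have h2 : vol μ x₀ (dist x₀ x) ≤ e := by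
        rw [mem_closedBall, dist_comm] at hxs
        have := hv.vol_mono x₀ hxs
        linarith
      have h3 := vol_nonneg (μ := μ) x₀ (dist x₀ x)
      have h4 : |k x y - k x₀ y| ≤ |C₁| * e ^ η₁ * vol μ x₀ (dist x₀ y) ^ (-(η₁ + 1 / β)) := by
        refine h1.trans ?_
        rw [show -η₁ - 1 / β = -(η₁ + 1 / β) by ring]
        gcongr
        exact le_abs_self _
      refine (mul_le_mul h4 (hfb y) (abs_nonneg _) (by positivity)).trans_eq ?_
      rw [invVol, Real.inv_rpow hy0.le, Real.inv_rpow hy0.le, ← Real.rpow_neg hy0.le,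
        ← Real.rpow_neg hy0.le, ← hconj, Real.rpow_add hy0]
      ring
  calc _ ≤ ∫⁻ y, T.indicator (fun y => ENNReal.ofReal (|C₁| * D * e ^ η₁) *
        ENNReal.ofReal (invVol μ x₀ y ^ (1 + η₁))) y ∂μ :=
        (lintegral_mono hpt).trans (lintegral_mono' Measure.restrict_le_self le_rfl)
    _ ≤ ENNReal.ofReal (|C₁| * D * e ^ η₁) *
        ENNReal.ofReal (1 * (1 + η₁) / (1 + η₁ - 1) * (e⁻¹) ^ (1 + η₁ - 1)) := by
        rw [lintegral_indicator hTm, lintegral_const_mul' _ _ ENNReal.ofReal_ne_top]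
        gcongr
        exact (hv.weakOne_invVol x₀).setLIntegral_rpow_le_of_le zero_le_one
              (hv.measurable_invVol x₀) (invVol_nonneg x₀) (by linarith) (by positivity)
    _ = _ := by
        rw [← ENNReal.ofReal_mul (by positivity), Real.inv_rpow he0.le, add_sub_cancel_left]
        congr 1
        field_simp

/-- For each annulus around the base point there is a function with vanishing moments whose
potential nearly attains its norm on a smaller ball, with uniform bounds. -/
theorem exists_extremal (hv : HasContinuousVolume μ) {k : M → M → ℝ}
    (hkm : Measurable (Function.uncurry k)) {β β' K : ℝ} (hβ : β.HolderConjugate β') (hK : 0 ≤ K)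
    (hw : ∀ x, WeakOne μ (fun y => |k x y| ^ β) K) {x₀ : M} {η₁ C₁ : ℝ} (hη₁ : 0 < η₁)
    (hx : ∀ r > 0, ∀ R > 0, (1 + 1) * vol μ x₀ r ≤ vol μ x₀ R →
      ∀ x' ∈ closedBall x₀ r, ∀ y ∉ closedBall x₀ R, 0 < vol μ x₀ (dist x₀ y) →
        |k x' y - k x₀ y| ≤
          C₁ * vol μ x₀ (dist x₀ x') ^ η₁ * vol μ x₀ (dist x₀ y) ^ (-η₁ - 1 / β))
    {m : ℕ} {p : Fin m → M → ℝ} (hpm : ∀ j, Measurable (p j))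
    (hpb : ∀ r > 0, ∀ j, ∃ K : ℝ, ∀ y ∈ closedBall x₀ r, |p j y| ≤ K)
    (hli : ∀ r > 0, 0 < vol μ x₀ r → ∀ c : Fin m → ℝ,
      (∀ᵐ y ∂μ.restrict (closedBall x₀ r), ∑ j, c j * p j y = 0) → c = 0) {C₂ : ℝ}
    (hC₂ : ∀ r > 0, 0 < vol μ x₀ r → ∀ v : Fin m → M → ℝ,
      (∀ j, v j ∈ Submodule.span ℝ (range p)) →
      (∀ i j, ∫ y in closedBall x₀ r, v i y * v j y ∂μ = if i = j then 1 else 0) →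
      ∀ j, ∀ y ∈ closedBall x₀ r, |v j y| ≤ C₂ / √(vol μ x₀ r)) {B : ℝ} (hB : 0 ≤ B) :
    ∃ C ≥ 0, ∀ r₁ r₂, 0 < vol μ x₀ r₁ → vol μ x₀ r₁ < vol μ x₀ r₂ →
      (∀ y, r₁ ≤ dist x₀ y → dist x₀ y ≤ r₂ →
        |k x₀ y| ≤ B * vol μ x₀ (dist x₀ y) ^ (-(1 / β))) →
      ∃ (f : M → ℝ) (L : ℝ) (S : Set M), Measurable f ∧ Function.support f ⊆ closedBall x₀ r₂ ∧
        (∀ᵐ y ∂μ, |f y| ≤ C * invVol μ x₀ y ^ (1 / β')) ∧ (∀ j, ∫ y, p j y * f y ∂μ = 0) ∧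
        0 ≤ L ∧ annulusIntegral μ k β x₀ r₁ r₂ = ENNReal.ofReal L ∧
        normPow μ β' f ≤ ENNReal.ofReal (L + C) ∧
        MeasurableSet S ∧ μ S = ENNReal.ofReal (vol μ x₀ r₁ / 4) ∧
        ∀ x ∈ S, |potential μ k f x - L| ≤ C := by
  have hβ0 := hβ.pos
  have hβ0' := hβ.symm.pos
  have hβ1' : 0 < β' - 1 := hβ.symm.sub_one_pos
  have hconj := hβ.inv_add_inv_eq_one
  have hconj₁ : 0 < 1 - 1 / β := sub_pos.2 ((div_lt_one hβ0).2 hβ.lt)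
  have hconj₂ : 0 < 1 - 1 / β' := sub_pos.2 ((div_lt_one hβ0').2 hβ.symm.lt)
  set D := B ^ (β - 1) with hD
  have hD0 : 0 ≤ D := by positivity
  set c₁ := D * (1 + 1 * (1 / β') / (1 - 1 / β')) with hc₁
  have hc₁0 : 0 ≤ c₁ := by positivity
  set E := m * C₂ ^ 2 * c₁ with hE
  have hE0 : 0 ≤ E := by positivity
  set c₂ := β' * 2 ^ (β' - 1) * (E * D ^ (β' - 1) * (1 + 1 * (1 / β) / (1 - 1 / β)) + E ^ β')
    with hc₂
  have hc₂0 : 0 ≤ c₂ := by positivity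
  have h11 : 0 < 1 + η₁ - 1 := by linarith
  set c₃ := |C₁| * D * (1 * (1 + η₁) / (1 + η₁ - 1)) with hc₃
  have hc₃0 : 0 ≤ c₃ := by positivity
  set c₄ := E * (1 + K * (1 / β) / (1 - 1 / β)) with hc₄
  have hc₄0 : 0 ≤ c₄ := by positivity
  refine ⟨D + E + c₂ + c₃ + c₄, by positivity, ?_⟩
  intro r₁ r₂ hr₁ hr₁₂ hbd
  have hr₂ := hr₁.trans hr₁₂
  have hr₂0 := hv.pos_of_vol_pos hr₂
  set ρ := vol μ x₀ r₂ with hρ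
  set F := closedBall x₀ r₂ with hFd
  have hF : MeasurableSet F := isClosed_closedBall.measurableSet
  have hμF : μ F = ENNReal.ofReal ρ := (hv.ofReal_vol x₀ r₂).symm
  have : IsFiniteMeasure (μ.restrict F) := ⟨by rw [Measure.restrict_apply_univ, hμF]; simp⟩
  set A := {y | r₁ ≤ dist x₀ y ∧ dist x₀ y ≤ r₂} with hAd
  have hA : MeasurableSet A := measurableSet_annulus x₀ r₁ r₂
  have hAF : A ⊆ F := fun y hy => by rw [hFd, mem_closedBall, dist_comm]; exact hy.2
  set f₀ := dualDensity k β x₀ r₁ r₂ with hf₀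
  have hf₀m : Measurable f₀ := measurable_dualDensity hkm β x₀ r₁ r₂
  have hf₀b : ∀ y, |f₀ y| ≤ D * invVol μ x₀ y ^ (1 / β') := abs_dualDensity_le hβ hB hv hr₁ hbd
  have hf₀c := abs_dualDensity_le_const hβ hB hv hr₁ hbd
  have hf₀z : ∀ y ∉ A, f₀ y = 0 := fun y hy => indicator_of_notMem hy _
  have hf₀A : ∀ y ∈ A, f₀ y = k x₀ y * |k x₀ y| ^ (β - 2) := fun y hy => indicator_of_mem hy _
  have hI : ∫ y in F, |f₀ y| ∂μ ≤ c₁ * ρ ^ (1 / β) := by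
    refine (le_abs_self _).trans (abs_integral_le_of_lintegral_enorm_le (by positivity) ?_)
    have e0 : ∀ y, ‖|f₀ y|‖ₑ = ‖f₀ y‖ₑ := fun y => by
      rw [← ofReal_norm, ← ofReal_norm, Real.norm_eq_abs, Real.norm_eq_abs, abs_abs]
    simp_rw [e0]
    exact lintegral_enorm_le_of_le_invVol hv hβ hD0 hr₂ (Filter.Eventually.of_forall hf₀b)
  obtain ⟨b, hbm, hbb, hb0⟩ := exists_correction hv hr₂ hpm (hpb r₂ hr₂0) (hli r₂ hr₂0 hr₂)
    (hC₂ r₂ hr₂0 hr₂) hf₀m hf₀c hI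
  have hbE : ∀ y ∈ F, |b y| ≤ E * ρ ^ (-(1 / β')) := by
    intro y hy
    refine (hbb y hy).trans_eq ?_
    have : ρ ^ (-(1 / β')) = ρ ^ (1 / β) / ρ := by
      rw [← Real.rpow_sub_one hr₂.ne']
      congr 1
      simp only [one_div]
      linarith
    rw [this, hE]
    ring
  have hpow : ∀ y, |f₀ y| ^ β' = A.indicator (fun y => |k x₀ y| ^ β) y := by
    intro y
    by_cases hy : y ∈ A
    · rw [hf₀A y hy, indicator_of_mem hy, abs_mul_abs_rpow_sub_two hβ.lt,
        ← Real.rpow_mul (abs_nonneg _), hβ.sub_one_mul_conj]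
    · rw [hf₀z y hy, indicator_of_notMem hy, abs_zero, Real.zero_rpow hβ0'.ne']
  have hker : ∀ y, k x₀ y * f₀ y = A.indicator (fun y => |k x₀ y| ^ β) y := by
    intro y
    by_cases hy : y ∈ A
    · rw [hf₀A y hy, indicator_of_mem hy, mul_self_mul_abs_rpow_sub_two hβ.lt]
    · rw [hf₀z y hy, indicator_of_notMem hy, mul_zero]
  have hki : ∀ x, Integrable (k x) (μ.restrict F) := fun x =>
    ⟨(hkm.of_uncurry_left (x := x)).aestronglyMeasurable,
      (lintegral_kernel_le hβ hK hkm (hw x) hr₂ hμF.le).trans_lt ENNReal.ofReal_lt_top⟩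
  have hkf : ∀ x, Integrable (fun y => k x y * f₀ y) (μ.restrict F) := fun x =>
    (hki x).mul_bdd hf₀m.aestronglyMeasurable (Filter.Eventually.of_forall hf₀c)
  have hkb : ∀ x, Integrable (fun y => k x y * b y) (μ.restrict F) := by
    intro x
    refine (hki x).mul_bdd (c := E * ρ ^ (-(1 / β'))) hbm.aestronglyMeasurable ?_
    filter_upwards [ae_restrict_mem hF] with y hy using hbE y hy
  set L := ∫ y in F, k x₀ y * f₀ y ∂μ with hL
  have hind0 : ∀ y, 0 ≤ k x₀ y * f₀ y := by
    intro y
    rw [hker]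
    exact indicator_nonneg (fun y _ => by positivity) y
  have hL0 : 0 ≤ L := integral_nonneg hind0
  have hLF : ENNReal.ofReal L = ∫⁻ y in F, ENNReal.ofReal (|f₀ y| ^ β') ∂μ := by
    rw [hL, ofReal_integral_eq_lintegral_ofReal (hkf x₀) (Filter.Eventually.of_forall hind0)]
    simp_rw [hker, hpow]
  have hLA : annulusIntegral μ k β x₀ r₁ r₂ = ENNReal.ofReal L := by
    have e1 : ∀ y, ENNReal.ofReal (A.indicator (fun y => |k x₀ y| ^ β) y) =
        A.indicator (fun y => ENNReal.ofReal (|k x₀ y| ^ β)) y := by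
      intro y
      by_cases hy : y ∈ A <;> simp [hy]
    rw [hLF]
    simp_rw [hpow, e1]
    rw [lintegral_indicator hA, Measure.restrict_restrict hA, inter_eq_left.2 hAF]
    rfl
  obtain ⟨s, hs0, hs⟩ := hv.exists_vol_eq (x := x₀) (t := vol μ x₀ r₁ / 4) (r := r₁)
    (by linarith) (by linarith)
  set f : M → ℝ := F.indicator fun y => f₀ y - b y with hf
  have hrest : ∀ g : M → ℝ, ∫ y, g y * f y ∂μ = ∫ y in F, g y * (f₀ y - b y) ∂μ := by
    intro g
    rw [← integral_indicator hF]
    refine integral_congr_ae (Filter.Eventually.of_forall fun y => ?_)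
    by_cases hy : y ∈ F <;> simp [hf, hy]
  refine ⟨f, L, closedBall x₀ s, (hf₀m.sub hbm).indicator hF, support_indicator_subset, ?_, ?_, hL0,
    hLA, ?_, isClosed_closedBall.measurableSet, ?_, ?_⟩
  · filter_upwards [hv.ae_vol_dist_pos x₀] with y hy
    have h0 : 0 ≤ invVol μ x₀ y := invVol_nonneg x₀ y
    by_cases hyF : y ∈ F
    · rw [hf, indicator_of_mem hyF]
      have h1 : vol μ x₀ (dist x₀ y) ≤ ρ := by
        rw [hFd, mem_closedBall, dist_comm] at hyF
        exact hv.vol_mono x₀ hyF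
      -- Inside the ball the constant size of `b` is dominated by the same profile as `f₀`. This
      -- fails where the volume vanishes, as `invVol` is `0` there, hence the almost everywhere
      -- form.
      have h2 : ρ ^ (-(1 / β')) ≤ invVol μ x₀ y ^ (1 / β') := by
        rw [Real.rpow_neg hr₂.le, ← Real.inv_rpow hr₂.le]
        exact Real.rpow_le_rpow (by positivity) (inv_anti₀ hy h1) (by positivity)
      calc |f₀ y - b y| ≤ |f₀ y| + |b y| := abs_sub _ _
        _ ≤ D * invVol μ x₀ y ^ (1 / β') + E * invVol μ x₀ y ^ (1 / β') :=
            add_le_add (hf₀b y) ((hbE y hyF).trans (by gcongr))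
        _ = (D + E) * invVol μ x₀ y ^ (1 / β') := by ring
        _ ≤ _ := mul_le_mul_of_nonneg_right (by linarith) (by positivity)
    · rw [hf, indicator_of_notMem hyF, abs_zero]
      positivity
  · intro j
    rw [hrest]
    exact hb0 j
  · rw [normPow_eq_lintegral μ hβ0']
    have e2 : ∀ y, ‖f y‖ₑ ^ β' = F.indicator (fun y => ENNReal.ofReal (|f₀ y - b y| ^ β')) y := by
      intro y
      by_cases hy : y ∈ F
      · rw [hf, indicator_of_mem hy, indicator_of_mem hy, ← ofReal_norm, Real.norm_eq_abs,
          ENNReal.ofReal_rpow_of_nonneg (abs_nonneg _) hβ0'.le]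
      · rw [hf, indicator_of_notMem hy, indicator_of_notMem hy, enorm_zero,
          ENNReal.zero_rpow_of_pos hβ0']
    simp_rw [e2]
    rw [lintegral_indicator hF]
    refine (lintegral_abs_sub_rpow_le hv hβ hD0 hE0 hr₂ hf₀m hf₀b hbE).trans ?_
    rw [← hLF, ← hc₂, ← ENNReal.ofReal_add hL0 hc₂0]
    exact ENNReal.ofReal_le_ofReal (by linarith)
  · rw [← hv.ofReal_vol, hs]
  · intro x hxs
    -- `L` is itself `∫ k(x₀,·) f₀`. The first error is handled by regularity in `x`, the second by
    -- the size of `b` and the local `L¹` bound for the kernel.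
    have h1 : potential μ k f x - L =
        ∫ y in F, (k x y - k x₀ y) * f₀ y ∂μ - ∫ y in F, k x y * b y ∂μ := by
      rw [potential, hrest]
      simp_rw [mul_sub, sub_mul]
      rw [integral_sub (hkf x) (hkb x), integral_sub (hkf x) (hkf x₀)]
      ring
    have h2 : |∫ y in F, (k x y - k x₀ y) * f₀ y ∂μ| ≤ c₃ := by
      refine abs_integral_kernel_sub_le (r₁ := r₁) hv hβ hD0 hη₁ hx (by rw [hs]; linarith)
        (by rw [hs]; ring) hf₀b (fun y hy => hf₀z y fun hyA => ?_) hxs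
      exact absurd hyA.1 (not_le.2 hy)
    have h3 : |∫ y in F, k x y * b y ∂μ| ≤ c₄ := by
      refine abs_integral_le_of_lintegral_enorm_le hc₄0 ?_
      calc _ ≤ ∫⁻ y in F, ENNReal.ofReal (E * ρ ^ (-(1 / β'))) * ‖k x y‖ₑ ∂μ := by
            refine setLIntegral_mono' hF fun y hy => ?_
            rw [enorm_mul, mul_comm, ← ofReal_norm (b y)]
            gcongr
            exact hbE y hy
        _ ≤ ENNReal.ofReal (E * ρ ^ (-(1 / β'))) *
            ENNReal.ofReal ((1 + K * (1 / β) / (1 - 1 / β)) * ρ ^ (1 / β')) := by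
            rw [lintegral_const_mul' _ _ ENNReal.ofReal_ne_top]
            gcongr
            exact lintegral_kernel_le hβ hK hkm (hw x) hr₂ hμF.le
        _ = _ := by
            rw [← ENNReal.ofReal_mul (by positivity)]
            congr 1
            have h4 : ρ ^ (-(1 / β')) * ρ ^ (1 / β') = 1 := by
              rw [← Real.rpow_add hr₂, neg_add_cancel, Real.rpow_zero]
            linear_combination (E * (1 + K * (1 / β) / (1 - 1 / β))) * h4
    rw [h1]
    refine (abs_sub _ _).trans ?_
    linarith

end

/-! ### Normalized extremal families -/

section
variable {α : Type*} [MeasurableSpace α] {μ : Measure α}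

theorem potential_const_mul (k : α → α → ℝ) (a : ℝ) (f : α → ℝ) :
    potential μ k (fun y => a * f y) = fun x => a * potential μ k f x := by
  ext x
  rw [potential, potential, ← integral_const_mul]
  congr 1
  ext y
  ring

theorem normPow_const_mul {q a : ℝ} (hq : 0 < q) (ha : 0 ≤ a) (g : α → ℝ) :
    normPow μ q (fun y => a * g y) = ENNReal.ofReal (a ^ q) * normPow μ q g := by
  rw [normPow_eq_lintegral μ hq, normPow_eq_lintegral μ hq, ← lintegral_const_mul' _ _
    ENNReal.ofReal_ne_top]
  refine lintegral_congr fun y => ?_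
  rw [enorm_mul, ENNReal.mul_rpow_of_nonneg _ _ hq.le, ← ofReal_norm a, Real.norm_eq_abs,
    abs_of_nonneg ha, ENNReal.ofReal_rpow_of_nonneg ha hq.le]

end

/-- Since `β/β' = β - 1`, the scaled power is `N (u/N)^β`; Bernoulli's inequality shows that an
error `c` in `u` costs only `βc`. -/
theorem rpow_scaled_bounds {β β' N c u : ℝ} (hβ : β.HolderConjugate β') (hN : 0 < N)
    (hcN : c ≤ N) (hl : N - c ≤ u) (hu : u ≤ N) :
    N - β * c ≤ |N ^ (-(1 / β')) * u| ^ β ∧ |N ^ (-(1 / β')) * u| ^ β ≤ N := by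
  have hβ0 := hβ.pos
  have hu0 : 0 ≤ u := by linarith
  have hexp : -(1 / β') * β = 1 - β := by
    have h1 := hβ.inv_add_inv_eq_one
    have h2 := mul_inv_cancel₀ hβ.ne_zero
    rw [one_div]
    have h3 : β'⁻¹ = 1 - β⁻¹ := by linarith
    rw [h3]
    linear_combination h2
  have e1 : |N ^ (-(1 / β')) * u| ^ β = N * (u / N) ^ β := by
    rw [abs_of_nonneg (by positivity), Real.mul_rpow (by positivity) hu0, ← Real.rpow_mul hN.le,
      hexp, Real.div_rpow hu0 hN.le, Real.rpow_sub hN, Real.rpow_one]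
    ring
  rw [e1]
  constructor
  · have h1 := one_add_mul_self_le_rpow_one_add (s := -(c / N))
      (by rw [neg_le_neg_iff, div_le_one hN]; exact hcN) hβ.lt.le
    have h2 : (1 + -(c / N)) ^ β ≤ (u / N) ^ β := by
      refine Real.rpow_le_rpow ?_ ?_ hβ0.le
      · linarith [(div_le_one hN).2 hcN]
      · rw [le_div_iff₀ hN]
        field_simp
        linarith
    have h3 : N - β * c = N * (1 + β * -(c / N)) := by field_simp; ring
    rw [h3]
    exact mul_le_mul_of_nonneg_left (h1.trans h2) hN.le
  · have : (u / N) ^ β ≤ 1 := Real.rpow_le_one (by positivity) ((div_le_one hN).2 hu) hβ0.le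
    nlinarith

section
variable {M : Type*} [MetricSpace M] [MeasurableSpace M] {μ : Measure M}

/-- There are admissible functions whose potentials `u` satisfy `|u|^β = N + O(1)` on a set of
measure at least `c ρ e^{-N/A}`, and `‖u‖_p^p ≤ C ρ N^{-p/β'}`, with `N` arbitrarily large and
`ρ ∈ I`. -/
def HasExtremals (μ : Measure M) (k : M → M → ℝ) (β β' p κ A : ℝ) (I : Set ℝ) : Prop :=
  ∃ c > 0, ∃ C ≥ 0, ∀ N₀ : ℝ, ∃ N ≥ N₀, ∃ ρ ∈ I, 0 < ρ ∧ ∃ f S, Admissible μ k β' κ f ∧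
    normPow μ p (potential μ k f) ≤ ENNReal.ofReal (C * ρ * N ^ (-(p / β'))) ∧
    MeasurableSet S ∧ ENNReal.ofReal (c * ρ * Real.exp (-(A⁻¹ * N))) ≤ μ S ∧
    ∀ x ∈ S, N - C ≤ |potential μ k f x| ^ β ∧ |potential μ k f x| ^ β ≤ N

variable [BorelSpace M]

theorem hasExtremals_of_annuli (hv : HasContinuousVolume μ) {k : M → M → ℝ}
    (hkm : Measurable (Function.uncurry k)) {β β' K : ℝ} (hβ : β.HolderConjugate β') (hK : 0 ≤ K)
    (hw₁ : ∀ x, WeakOne μ (fun y => |k x y| ^ β) K)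
    (hw₂ : ∀ y, WeakOne μ (fun x => |k x y| ^ β) K) {x₀ : M} {η₁ η : ℝ} (hη₁ : 0 < η₁)
    (hη : 0 ≤ η) (hx : IsXRegularAt μ k β x₀ η₁) (hy : HasTaylorFormulaAt μ k β x₀ η) {p κ : ℝ}
    (hp : 0 < p) (hpη : 1 < (η + 1 / β) * p) {I : Set ℝ}
    (hκ : κ = 0 ∨ (1 < (η + 1 / β) * β' ∧ 0 ≤ κ ∧ ∀ ρ ∈ I, ρ ≤ 1)) {A B C_A : ℝ} (hA : 0 < A)
    (hB : 0 ≤ B)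
    (hann : ∀ Λ : ℝ, ∃ r₁ r₂, 0 < vol μ x₀ r₁ ∧ vol μ x₀ r₁ < vol μ x₀ r₂ ∧ vol μ x₀ r₂ ∈ I ∧
      Λ ≤ Real.log (vol μ x₀ r₂ / vol μ x₀ r₁) ∧
      (∀ y, r₁ ≤ dist x₀ y → dist x₀ y ≤ r₂ →
        |k x₀ y| ≤ B * vol μ x₀ (dist x₀ y) ^ (-(1 / β))) ∧
      ENNReal.ofReal (A * Real.log (vol μ x₀ r₂ / vol μ x₀ r₁) - C_A) ≤
        annulusIntegral μ k β x₀ r₁ r₂) :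
    HasExtremals μ k β β' p κ A I := by
  have hβ0 := hβ.pos
  have hβ0' := hβ.symm.pos
  obtain ⟨m, -, κf, pf, -, hpm, hpb, hli, hT, C₂, hC₂⟩ := hy
  obtain ⟨C₁, hC₁⟩ := hx 1 one_pos
  obtain ⟨C₀, hC₀⟩ := hT 1 one_pos
  obtain ⟨C, hC, hex⟩ := exists_extremal hv hkm hβ hK hw₁ hη₁ hC₁ hpm hpb hli hC₂ hB
  obtain ⟨Cp, hCp, hLp⟩ := lintegral_potential_rpow_le hv hkm hβ hw₁ hw₂ hη hpm hpb hC₀ hC hp hpη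
  -- For `κ ≠ 0` the `L^q` estimate with `q = β'` bounds the extra term by `O(ρ)`, and `ρ ≤ 1` makes
  -- it a constant that the normalization absorbs.
  obtain ⟨C₅, hC₅, hκb⟩ : ∃ C₅ ≥ 0, ∀ r, 0 < vol μ x₀ r → vol μ x₀ r ∈ I → ∀ f : M → ℝ,
      Measurable f → Function.support f ⊆ closedBall x₀ r →
      (∀ᵐ y ∂μ, |f y| ≤ C * invVol μ x₀ y ^ (1 / β')) → (∀ j, ∫ y, pf j y * f y ∂μ = 0) →
      ENNReal.ofReal κ * normPow μ β' (potential μ k f) ≤ ENNReal.ofReal C₅ := by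
    rcases hκ with rfl | ⟨h1, h2, h3⟩
    · exact ⟨0, le_rfl, by simp⟩
    · obtain ⟨C', hC', hLq⟩ := lintegral_potential_rpow_le hv hkm hβ hw₁ hw₂ hη hpm hpb hC₀ hC
        hβ0' h1
      refine ⟨κ * C', by positivity, fun r hr hrI f hf hs hb hm => ?_⟩
      rw [ENNReal.ofReal_mul h2]
      gcongr
      refine (hLq r hr f hf hs hb hm).trans (ENNReal.ofReal_le_ofReal ?_)
      exact mul_le_of_le_one_right hC' (h3 _ hrI)
  set c₆ := 2 * C + C₅ with hc₆
  have hc₆0 : 0 ≤ c₆ := by positivity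
  refine ⟨Real.exp (-(A⁻¹ * C_A)) / 4, by positivity, Cp + β * c₆, by positivity, fun N₀ => ?_⟩
  obtain ⟨r₁, r₂, hr₁, hr₁₂, hrI, hΛ, hbd, hprop⟩ := hann (A⁻¹ * (max N₀ 1 + c₆ + C_A))
  obtain ⟨f, L, S, hfm, hfs, hfb, hfmom, hL0, hL, hfn, hSm, hS, hfS⟩ := hex r₁ r₂ hr₁ hr₁₂ hbd
  set ρ := vol μ x₀ r₂ with hρ
  have hr₂ : 0 < ρ := hr₁.trans hr₁₂
  rw [hL, ENNReal.ofReal_le_ofReal_iff hL0] at hprop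
  have hLbig : max N₀ 1 + c₆ ≤ L := by
    have := mul_le_mul_of_nonneg_left hΛ hA.le
    rw [mul_inv_cancel_left₀ hA.ne'] at this
    linarith
  have hN₀ := le_max_left N₀ 1
  have h1N := le_max_right N₀ 1
  -- `N` bounds the whole constraint functional of `f`, so scaling by `N^{-1/β'}` makes `f`
  -- admissible. On `S` the potential lies in `[L - C, L + C]`, and `L - C = N - c₆`.
  set N := L + C + C₅ with hN
  have hN0 : 0 < N := by linarith
  set a := N ^ (-(1 / β')) with ha
  have ha0 : 0 ≤ a := by positivity
  have haβ : a ^ β' = N⁻¹ := by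
    rw [ha, ← Real.rpow_mul hN0.le, neg_mul, one_div_mul_cancel hβ0'.ne', Real.rpow_neg_one]
  refine ⟨N, by linarith, ρ, hrI, hr₂, fun y => a * f y, S, ⟨hfm.const_mul a, ⟨x₀, r₂, ?_⟩, ?_⟩,
    ?_, hSm, ?_, ?_⟩
  · exact (Function.support_mul_subset_right _ _).trans hfs
  · rw [potential_const_mul, normPow_const_mul hβ0' ha0, normPow_const_mul hβ0' ha0, haβ]
    calc _ = ENNReal.ofReal N⁻¹ * (normPow μ β' f +
          ENNReal.ofReal κ * normPow μ β' (potential μ k f)) := by ring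
      _ ≤ ENNReal.ofReal N⁻¹ * (ENNReal.ofReal (L + C) + ENNReal.ofReal C₅) := by
          gcongr
          exact hκb r₂ hr₂ hrI f hfm hfs hfb hfmom
      _ = 1 := by
          rw [← ENNReal.ofReal_add (by positivity) hC₅, ← ENNReal.ofReal_mul (by positivity), ← hN,
            inv_mul_cancel₀ hN0.ne', ENNReal.ofReal_one]
  · rw [potential_const_mul, normPow_const_mul hp ha0]
    calc _ ≤ ENNReal.ofReal (a ^ p) * ENNReal.ofReal (Cp * ρ) := by
          gcongr
          exact hLp r₂ hr₂ f hfm hfs hfb hfmom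
      _ ≤ _ := by
          rw [← ENNReal.ofReal_mul (by positivity)]
          refine ENNReal.ofReal_le_ofReal ?_
          have : a ^ p = N ^ (-(p / β')) := by
            rw [ha, ← Real.rpow_mul hN0.le]
            congr 1
            ring
          rw [this, mul_comm]
          have h0 : 0 ≤ N ^ (-(p / β')) := by positivity
          have h5 : Cp ≤ Cp + β * c₆ := by linarith [mul_nonneg hβ0.le hc₆0]
          gcongr
  · rw [hS]
    refine ENNReal.ofReal_le_ofReal ?_
    -- Properness read backwards: the logarithm is bounded by `(L + C_A)/A` with `L ≤ N`, so `S`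
    -- cannot be too small.
    have h1 : Real.log (ρ / vol μ x₀ r₁) ≤ A⁻¹ * (N + C_A) := by
      rw [← div_eq_inv_mul, le_div_iff₀ hA]
      linarith
    have h2 : ρ / vol μ x₀ r₁ ≤ Real.exp (A⁻¹ * (N + C_A)) := by
      rwa [← Real.log_le_iff_le_exp (by positivity)]
    rw [div_le_iff₀ hr₁] at h2
    have h3 : Real.exp (-(A⁻¹ * C_A)) * Real.exp (-(A⁻¹ * N)) *
        Real.exp (A⁻¹ * (N + C_A)) = 1 := by
      rw [← Real.exp_add, ← Real.exp_add, Real.exp_eq_one_iff]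
      ring
    have h4 : 0 < Real.exp (-(A⁻¹ * C_A)) * Real.exp (-(A⁻¹ * N)) := by positivity
    have h5 := mul_le_mul_of_nonneg_left h2 h4.le
    rw [← mul_assoc, h3] at h5
    linarith
  · intro x hxS
    have h1 := abs_le.1 (hfS x hxS)
    rw [potential_const_mul]
    have h2 := rpow_scaled_bounds hβ hN0 (c := c₆) (u := potential μ k f x) (by linarith)
      (by linarith) (by linarith)
    exact ⟨by linarith [h2.1], h2.2⟩

end

/-! ### Sharpness from extremal families -/

theorem exists_half_exp_le_expReg (n : ℕ) : ∃ T : ℝ, ∀ t ≥ T, Real.exp t / 2 ≤ expReg n t := by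
  have h : (fun t : ℝ => ∑ i ∈ Finset.range (n + 1), t ^ i / (i ! : ℝ)) =o[Filter.atTop]
      Real.exp := by
    refine Asymptotics.IsLittleO.fun_sum (A := fun (i : ℕ) (t : ℝ) => t ^ i / (i ! : ℝ))
      fun i _ => ?_
    simp_rw [div_eq_inv_mul]
    exact (Real.isLittleO_pow_exp_atTop (n := i)).const_mul_left _
  obtain ⟨T, hT⟩ := Filter.eventually_atTop.1 (h.bound (c := 1 / 2) (by norm_num))
  refine ⟨T, fun t ht => ?_⟩
  have h1 := (le_abs_self _).trans (hT t ht)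
  rw [Real.norm_of_nonneg (Real.exp_pos t).le] at h1
  rw [expReg]
  linarith

section
variable {α : Type*} [MeasurableSpace α] {μ : Measure α}

theorem exists_le_lintegral_expReg {β γ : ℝ} (hβ : 0 < β) (hγ : 0 < γ) (n : ℕ) (q a : ℝ) {c C : ℝ}
    (hc : 0 < c) :
    ∃ c' > 0, ∃ N₁ : ℝ, ∀ N ≥ N₁, ∀ ρ > 0, ∀ (u : α → ℝ) (S : Set α), MeasurableSet S →
      ENNReal.ofReal (c * ρ * Real.exp (-(a * N))) ≤ μ S →
      (∀ x ∈ S, N - C ≤ |u x| ^ β ∧ |u x| ^ β ≤ N) →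
      ENNReal.ofReal (c' * ρ * (Real.exp ((γ - a) * N) * N ^ (-(max q 0 / β)))) ≤
        ∫⁻ x, ENNReal.ofReal (expReg n (γ * |u x| ^ β) / (1 + |u x| ^ q)) ∂μ := by
  obtain ⟨T, hT⟩ := exists_half_exp_le_expReg n
  refine ⟨c * Real.exp (-(γ * C)) / 4, by positivity, max (max 1 (C + 1)) (C + T / γ), ?_⟩
  intro N hN ρ hρ u S hS hμS hu
  have hN1 : 1 ≤ N := (le_max_left _ _).trans ((le_max_left _ _).trans hN)
  have hNC : C + 1 ≤ N := (le_max_right _ _).trans ((le_max_left _ _).trans hN)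
  have hNT : C + T / γ ≤ N := (le_max_right _ _).trans hN
  have hN0 : 0 < N := by linarith
  -- The power `q` may be negative; `|u| ≥ 1` on `S` allows it to be replaced by `max q 0`.
  set P := N ^ (max q 0 / β) with hP
  have hP1 : 1 ≤ P := Real.one_le_rpow hN1 (by positivity)
  have hpt : ∀ x ∈ S, ENNReal.ofReal (Real.exp (γ * (N - C)) / 2 / (2 * P)) ≤
      ENNReal.ofReal (expReg n (γ * |u x| ^ β) / (1 + |u x| ^ q)) := by
    intro x hx
    obtain ⟨h1, h2⟩ := hu x hx
    refine ENNReal.ofReal_le_ofReal ?_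
    have hu1 : 1 ≤ |u x| := by
      by_contra! h
      have := Real.rpow_lt_one (abs_nonneg (u x)) h hβ
      linarith
    have h3 : |u x| ^ q ≤ P := by
      calc |u x| ^ q ≤ |u x| ^ (max q 0) := Real.rpow_le_rpow_of_exponent_le hu1 (le_max_left _ _)
        _ = (|u x| ^ β) ^ (max q 0 / β) := by
            rw [← Real.rpow_mul (abs_nonneg _), mul_div_cancel₀ _ hβ.ne']
        _ ≤ P := Real.rpow_le_rpow (by positivity) h2 (by positivity)
    have h4 : γ * (N - C) ≤ γ * |u x| ^ β := by gcongr
    have h5 : T ≤ γ * (N - C) := by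
      have : T / γ ≤ N - C := by linarith
      rw [div_le_iff₀ hγ] at this
      linarith
    have h6 : Real.exp (γ * (N - C)) / 2 ≤ expReg n (γ * |u x| ^ β) := by
      refine le_trans ?_ (hT _ (h5.trans h4))
      gcongr
    have h7 : 0 ≤ |u x| ^ q := by positivity
    exact div_le_div₀ (le_trans (by positivity) h6) h6 (by linarith) (by linarith)
  calc _ = ENNReal.ofReal (Real.exp (γ * (N - C)) / 2 / (2 * P)) *
        ENNReal.ofReal (c * ρ * Real.exp (-(a * N))) := by
        rw [← ENNReal.ofReal_mul (by positivity), Real.rpow_neg hN0.le, ← hP]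
        congr 1
        have : Real.exp (γ * (N - C)) * Real.exp (-(a * N)) =
            Real.exp (-(γ * C)) * Real.exp ((γ - a) * N) := by
          rw [← Real.exp_add, ← Real.exp_add]
          congr 1
          ring
        have h8 : Real.exp (γ * (N - C)) / 2 / (2 * P) * (c * ρ * Real.exp (-(a * N))) =
            (Real.exp (γ * (N - C)) * Real.exp (-(a * N))) * (c * ρ * P⁻¹ / 4) := by
          field_simp
          norm_num
        rw [h8, this]
        ring
    _ ≤ ENNReal.ofReal (Real.exp (γ * (N - C)) / 2 / (2 * P)) * μ S := by gcongr
    _ = ∫⁻ _ in S, ENNReal.ofReal (Real.exp (γ * (N - C)) / 2 / (2 * P)) ∂μ := by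
        rw [setLIntegral_const]
    _ ≤ ∫⁻ x in S, ENNReal.ofReal (expReg n (γ * |u x| ^ β) / (1 + |u x| ^ q)) ∂μ :=
        setLIntegral_mono' hS hpt
    _ ≤ _ := setLIntegral_le_lintegral _ _

theorem normPow_pos_of_set {β p N c : ℝ} (hβ : 0 < β) (hp : 0 < p) {u : α → ℝ} {S : Set α}
    (hS : MeasurableSet S) (hμS : 0 < μ S) (hN : c < N)
    (hu : ∀ x ∈ S, N - c ≤ |u x| ^ β) : 0 < normPow μ p u := by
  rw [normPow_eq_lintegral μ hp]
  calc 0 < ENNReal.ofReal (((N - c) ^ (1 / β)) ^ p) * μ S := by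
        have : 0 < N - c := by linarith
        exact ENNReal.mul_pos (ENNReal.ofReal_pos.2 (by positivity)).ne' hμS.ne'
    _ = ∫⁻ _ in S, ENNReal.ofReal (((N - c) ^ (1 / β)) ^ p) ∂μ := by rw [setLIntegral_const]
    _ ≤ ∫⁻ x in S, ‖u x‖ₑ ^ p ∂μ := by
        refine setLIntegral_mono' hS fun x hx => ?_
        rw [← ofReal_norm, Real.norm_eq_abs, ENNReal.ofReal_rpow_of_nonneg (abs_nonneg _) hp.le]
        refine ENNReal.ofReal_le_ofReal (Real.rpow_le_rpow ?_ ?_ hp.le)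
        · exact Real.rpow_nonneg (by linarith) _
        · calc (N - c) ^ (1 / β) ≤ (|u x| ^ β) ^ (1 / β) :=
                Real.rpow_le_rpow (by linarith) (hu x hx) (by positivity)
            _ = |u x| := by
                rw [← Real.rpow_mul (abs_nonneg _), mul_one_div_cancel hβ.ne', Real.rpow_one]
    _ ≤ _ := setLIntegral_le_lintegral _ _

end

section
variable {M : Type*} [MetricSpace M] [MeasurableSpace M] {μ : Measure M} {k : M → M → ℝ}
  {β β' p κ A : ℝ} {I : Set ℝ}

/-- Both the lower bound for the integral and the upper bound for the norm carry one factor `ρ`,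
which cancels; hence no control of `ρ` is needed. -/
theorem HasExtremals.ratio_unbounded (h : HasExtremals μ k β β' p κ A I)
    (hβ : β.HolderConjugate β') (hp : 0 < p) {γ q : ℝ} (hγ : 0 < γ)
    (hlim : Filter.Tendsto (fun N : ℝ => Real.exp ((γ - A⁻¹) * N) * N ^ (p / β' - max q 0 / β))
      Filter.atTop Filter.atTop) (Λ : ℝ) :
    ∃ f, Admissible μ k β' κ f ∧ 0 < normPow μ p (potential μ k f) ∧
      normPow μ p (potential μ k f) < ∞ ∧
      ENNReal.ofReal Λ * normPow μ p (potential μ k f) < growthIntegral μ k β p γ q f := by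
  obtain ⟨c, hc, C, hC, hN⟩ := h
  obtain ⟨c', hc', N₁, hN₁⟩ := exists_le_lintegral_expReg (μ := μ) hβ.pos hγ ⌈p / β - 1⌉₊ q A⁻¹
    (C := C) hc
  obtain ⟨N₂, hN₂⟩ := Filter.eventually_atTop.1 (hlim.eventually_gt_atTop (|Λ| * C / c'))
  obtain ⟨N, hNge, ρ, -, hρ, f, S, hf, hnorm, hS, hμS, hu⟩ := hN (max (max N₁ N₂) (C + 1))
  have h1 : N₁ ≤ N := (le_max_left _ _).trans ((le_max_left _ _).trans hNge)
  have h2 : N₂ ≤ N := (le_max_right _ _).trans ((le_max_left _ _).trans hNge)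
  have h3 : C + 1 ≤ N := (le_max_right _ _).trans hNge
  have hN0 : 0 < N := by linarith
  have hSpos : 0 < μ S := (ENNReal.ofReal_pos.2 (by positivity)).trans_le hμS
  refine ⟨f, hf, normPow_pos_of_set hβ.pos hp hS hSpos (by linarith) fun x hx => (hu x hx).1,
    hnorm.trans_lt ENNReal.ofReal_lt_top, ?_⟩
  refine lt_of_lt_of_le ?_ (hN₁ N h1 ρ hρ _ S hS hμS hu)
  calc _ ≤ ENNReal.ofReal |Λ| * ENNReal.ofReal (C * ρ * N ^ (-(p / β'))) := by
        gcongr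
        exact le_abs_self Λ
    _ = ENNReal.ofReal (|Λ| * (C * ρ * N ^ (-(p / β')))) :=
        (ENNReal.ofReal_mul (abs_nonneg _)).symm
    _ < _ := by
        rw [ENNReal.ofReal_lt_ofReal_iff (by positivity)]
        have h4 := hN₂ N h2
        rw [div_lt_iff₀ hc'] at h4
        have h5 : N ^ (-(max q 0 / β)) = N ^ (p / β' - max q 0 / β) * N ^ (-(p / β')) := by
          rw [← Real.rpow_add hN0]
          congr 1
          ring
        rw [h5]
        have h6 : 0 < ρ * N ^ (-(p / β')) := by positivity
        have h7 := mul_lt_mul_of_pos_right h4 h6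
        calc _ = |Λ| * C * (ρ * N ^ (-(p / β'))) := by ring
          _ < _ := h7
          _ = _ := by ring

theorem tendsto_exp_mul_rpow_atTop {b : ℝ} (hb : 0 < b) (s : ℝ) :
    Filter.Tendsto (fun N : ℝ => Real.exp (b * N) * N ^ s) Filter.atTop Filter.atTop := by
  refine (tendsto_exp_mul_div_rpow_atTop (-s) b hb).congr' ?_
  filter_upwards [Filter.eventually_gt_atTop 0] with N hN
  rw [Real.rpow_neg hN.le, div_inv_eq_mul]

theorem HasExtremals.expConstantSharp (h : HasExtremals μ k β β' p κ A I)
    (hβ : β.HolderConjugate β') (hp : 0 < p) (hA : 0 < A) :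
    ExpConstantSharp μ k β β' p κ A⁻¹ := fun _ hγ Λ =>
  h.ratio_unbounded hβ hp ((inv_pos.2 hA).trans hγ)
    (tendsto_exp_mul_rpow_atTop (sub_pos.2 hγ) _) Λ

theorem HasExtremals.denominatorPowerSharp (h : HasExtremals μ k β β' p κ A I)
    (hβ : β.HolderConjugate β') (hp : 0 < p) (hA : 0 < A) :
    DenominatorPowerSharp μ k β β' p κ A⁻¹ := by
  intro q hq Λ
  refine h.ratio_unbounded hβ hp (inv_pos.2 hA) ?_ Λ
  have h1 : 0 < p / β' - max q 0 / β := by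
    have h2 : max q 0 < p * β / β' :=
      max_lt hq (div_pos (mul_pos hp hβ.pos) hβ.symm.pos)
    rw [sub_pos, div_lt_iff₀ hβ.pos]
    calc max q 0 < p * β / β' := h2
      _ = p / β' * β := by ring
  simpa using tendsto_rpow_atTop h1

/-- With `ρ` fixed, the two sides can be treated separately: the integral grows exponentially in `N`
while the norm decays like `N^{-p/β'}`. -/
theorem HasExtremals.expConstantStronglySharp {ρ₀ : ℝ}
    (h : HasExtremals μ k β β' p κ A {ρ₀}) (hβ : β.HolderConjugate β') (hp : 0 < p) (hA : 0 < A) :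
    ExpConstantStronglySharp μ k β β' p κ A⁻¹ := by
  intro γ hγ Λ ε hε
  obtain ⟨c, hc, C, hC, hN⟩ := h
  obtain ⟨c', hc', N₁, hN₁⟩ := exists_le_lintegral_expReg (μ := μ) hβ.pos
    ((inv_pos.2 hA).trans hγ) ⌈p / β - 1⌉₊ (p * β / β') A⁻¹ (C := C) hc
  have hρ₀ : 0 < ρ₀ := by
    obtain ⟨N, -, ρ, rfl, hρ, -⟩ := hN 0
    exact hρ
  have hlim₁ := (tendsto_exp_mul_rpow_atTop (sub_pos.2 hγ)
    (-(max (p * β / β') 0 / β))).eventually_gt_atTop (|Λ| / (c' * ρ₀))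
  have hlim₂ : ∀ᶠ N : ℝ in Filter.atTop, C * ρ₀ * N ^ (-(p / β')) < ε := by
    have := (tendsto_rpow_neg_atTop (div_pos hp hβ.symm.pos)).const_mul (C * ρ₀)
    rw [mul_zero] at this
    exact this.eventually_lt_const hε
  obtain ⟨N₂, hN₂⟩ := Filter.eventually_atTop.1 (hlim₁.and hlim₂)
  obtain ⟨N, hNge, ρ, rfl, hρ, f, S, hf, hnorm, hS, hμS, hu⟩ := hN (max (max N₁ N₂) (C + 1))
  have h1 : N₁ ≤ N := (le_max_left _ _).trans ((le_max_left _ _).trans hNge)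
  have h2 : N₂ ≤ N := (le_max_right _ _).trans ((le_max_left _ _).trans hNge)
  have h3 : C + 1 ≤ N := (le_max_right _ _).trans hNge
  have hN0 : 0 < N := by linarith
  have hSpos : 0 < μ S := (ENNReal.ofReal_pos.2 (by positivity)).trans_le hμS
  refine ⟨f, hf, normPow_pos_of_set hβ.pos hp hS hSpos (by linarith) fun x hx => (hu x hx).1,
    hnorm.trans_lt ((ENNReal.ofReal_lt_ofReal_iff hε).2 (hN₂ N h2).2), ?_⟩
  refine lt_of_lt_of_le ?_ (hN₁ N h1 ρ hρ _ S hS hμS hu)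
  rw [ENNReal.ofReal_lt_ofReal_iff (by positivity)]
  have h4 := (hN₂ N h2).1
  rw [div_lt_iff₀ (by positivity)] at h4
  linarith [le_abs_self Λ]

theorem HasExtremals.rufConstantSharp {ρ₀ : ℝ} (h : HasExtremals μ k β β' p κ A {ρ₀})
    (hβ : β.HolderConjugate β') (hA : 0 < A) : RufConstantSharp μ k β β' κ A⁻¹ := by
  intro γ hγ Λ
  obtain ⟨c, hc, C, hC, hN⟩ := h
  -- Power `0` makes the denominator the constant `2`, which is dropped at the end.
  obtain ⟨c', hc', N₁, hN₁⟩ := exists_le_lintegral_expReg (μ := μ) hβ.pos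
    ((inv_pos.2 hA).trans hγ) ⌈β' - 2⌉₊ 0 A⁻¹ (C := C) hc
  have hρ₀ : 0 < ρ₀ := by
    obtain ⟨N, -, ρ, rfl, hρ, -⟩ := hN 0
    exact hρ
  obtain ⟨N₂, hN₂⟩ := Filter.eventually_atTop.1 ((tendsto_exp_mul_rpow_atTop (sub_pos.2 hγ)
    (-(max 0 0 / β))).eventually_gt_atTop (|Λ| / (c' * ρ₀)))
  obtain ⟨N, hNge, ρ, rfl, hρ, f, S, hf, -, hS, hμS, hu⟩ := hN (max (max N₁ N₂) 1)
  have h1 : N₁ ≤ N := (le_max_left _ _).trans ((le_max_left _ _).trans hNge)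
  have h2 : N₂ ≤ N := (le_max_right _ _).trans ((le_max_left _ _).trans hNge)
  have hN0 : 0 < N := zero_lt_one.trans_le ((le_max_right _ _).trans hNge)
  refine ⟨f, hf, ?_⟩
  have h4 := hN₂ N h2
  rw [div_lt_iff₀ (by positivity)] at h4
  calc ENNReal.ofReal Λ < ENNReal.ofReal
        (c' * ρ * (Real.exp ((γ - A⁻¹) * N) * N ^ (-(max 0 0 / β)))) := by
        rw [ENNReal.ofReal_lt_ofReal_iff (by positivity)]
        linarith [le_abs_self Λ]
    _ ≤ _ := hN₁ N h1 ρ hρ _ S hS hμS hu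
    _ ≤ _ := by
        refine lintegral_mono fun x => ?_
        rcases le_total 0 (expReg ⌈β' - 2⌉₊ (γ * |potential μ k f x| ^ β)) with h0 | h0
        · refine ENNReal.ofReal_le_ofReal (div_le_self h0 ?_)
          simp
        · rw [ENNReal.ofReal_of_nonpos (div_nonpos_of_nonpos_of_nonneg h0 (by positivity))]
          exact bot_le

end

/-! ### Extremal families for proper kernels -/

section
variable {M : Type*} [MetricSpace M] [MeasurableSpace M] [BorelSpace M] {μ : Measure M}

/-- The identity `(η + 1/β) q = q(1 + η) - q/β'` turns the hypothesis into integrability of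
`V^{-(η+1/β)q}` at infinity. -/
theorem one_lt_taylor_exponent {β β' η q : ℝ} (hβ : β.HolderConjugate β') (hη : 0 ≤ η)
    (h : (1 + q / β') * (1 + η)⁻¹ < q) : 1 < (η + 1 / β) * q := by
  rw [← div_eq_mul_inv, div_lt_iff₀ (by linarith)] at h
  have h1 : 1 / β = 1 - 1 / β' := by
    have := hβ.inv_add_inv_eq_one
    simp only [one_div]
    linarith
  rw [h1]
  have h2 : (η + (1 - 1 / β')) * q = q * (1 + η) - q / β' := by ring
  linarith

theorem IsProperOnDiagonalAt.hasExtremals (hμ : μ ≠ 0) (hv : HasContinuousVolume μ)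
    {k : M → M → ℝ} {β β' A₀ p κ K B : ℝ} (hkm : Measurable (Function.uncurry k))
    (hβ : β.HolderConjugate β') (hA₀ : 0 < A₀) (hp : 0 < p) (hK : 0 ≤ K)
    (hw₁ : ∀ x, WeakOne μ (fun y => |k x y| ^ β) K)
    (hw₂ : ∀ y, WeakOne μ (fun x => |k x y| ^ β) K) (hB : 0 ≤ B)
    (hnear : PointwiseBoundNear μ k β B) {x₀ : M} {η₁ η : ℝ} (hη₁ : 0 < η₁) (hη : 0 ≤ η)
    (hx : IsXRegularAt μ k β x₀ η₁) (hy : HasTaylorFormulaAt μ k β x₀ η)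
    (hpη : 1 < (η + 1 / β) * p) (hκ : κ = 0 ∨ (1 < (η + 1 / β) * β' ∧ 0 ≤ κ))
    (h : IsProperOnDiagonalAt μ k β A₀ x₀) :
    ∃ ρ₀, HasExtremals μ k β β' p κ A₀ {ρ₀} := by
  obtain ⟨C, hC⟩ := h
  obtain ⟨r, hr⟩ := hv.exists_lt_vol x₀ (c := 0) (by
    simpa using (Measure.measure_univ_ne_zero.2 hμ).bot_lt)
  -- The outer radius is fixed once for all. The minimum keeps its volume in the range of the local
  -- hypotheses and allows for total mass below `1`.
  obtain ⟨r₂, hr₂0, hr₂⟩ := hv.exists_vol_eq (x := x₀) (t := min 1 (vol μ x₀ r)) (r := r)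
    (lt_min one_pos hr) (min_le_right _ _)
  have hρ1 : vol μ x₀ r₂ ≤ 1 := hr₂ ▸ min_le_left _ _
  have hρ0 : 0 < vol μ x₀ r₂ := hr₂ ▸ lt_min one_pos hr
  refine ⟨vol μ x₀ r₂, hasExtremals_of_annuli hv hkm hβ hK hw₁ hw₂ hη₁ hη hx hy hp hpη
    (hκ.imp_right fun h => ⟨h.1, h.2, fun ρ hρ => (mem_singleton_iff.1 hρ).trans_le hρ1⟩)
    (C_A := C) hA₀ hB fun Λ => ?_⟩
  have hΛ : 0 < max Λ 1 := lt_max_of_lt_right one_pos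
  have hlt : vol μ x₀ r₂ * Real.exp (-max Λ 1) < vol μ x₀ r₂ :=
    mul_lt_of_lt_one_right hρ0 (by rw [Real.exp_lt_one_iff]; linarith)
  obtain ⟨r₁, hr₁0, hr₁⟩ := hv.exists_vol_eq (x := x₀) (t := vol μ x₀ r₂ * Real.exp (-max Λ 1))
    (r := r₂) (by positivity) hlt.le
  have h1 : 0 < vol μ x₀ r₁ := by rw [hr₁]; positivity
  have h12 : vol μ x₀ r₁ < vol μ x₀ r₂ := by rw [hr₁]; exact hlt
  refine ⟨r₁, r₂, h1, h12, mem_singleton _, ?_, fun y hy1 hy2 => ?_, hC r₁ r₂ h1 h12 hρ1⟩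
  · rw [hr₁, div_mul_cancel_left₀ hρ0.ne', Real.exp_neg, inv_inv, Real.log_exp]
    exact le_max_left _ _
  · exact hnear x₀ y (h1.trans_le (hv.vol_mono x₀ hy1)) ((hv.vol_mono x₀ hy2).trans hρ1)

theorem IsProperAtInfinityAt.hasExtremals (hv : HasContinuousVolume μ)
    {k : M → M → ℝ} {β β' A₀ Ainf p : ℝ} (hk : IsRieszLike μ k β A₀ Ainf)
    (hβ : β.HolderConjugate β') (hp : 0 < p) {x₀ : M} {η₁ η : ℝ} (hη₁ : 0 < η₁) (hη : 0 ≤ η)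
    (hx : IsXRegularAt μ k β x₀ η₁) (hy : HasTaylorFormulaAt μ k β x₀ η)
    (hpη : 1 < (η + 1 / β) * p) (h : IsProperAtInfinityAt μ k β Ainf x₀) :
    HasExtremals μ k β β' p 0 Ainf univ := by
  obtain ⟨htop, hA, C, hC⟩ := h
  obtain ⟨K, hK, hw₁, hw₂⟩ := hk.exists_weakOne hv
  obtain ⟨B, hB, -, -, hb⟩ := hk.size
  have hex : ∀ t : ℝ, 0 < t → ∃ r, 0 < r ∧ vol μ x₀ r = t := by
    intro t ht
    obtain ⟨r, hr⟩ := hv.exists_lt_vol x₀ (c := t) (by rw [htop]; exact ENNReal.ofReal_lt_top)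
    exact hv.exists_vol_eq ht hr.le
  -- Here `ρ` is unbounded, so the bound `O(ρ)` on the `κ` term would be useless; the construction
  -- is carried out for `κ = 0`.
  refine hasExtremals_of_annuli hv hk.measurable hβ hK hw₁ hw₂ hη₁ hη hx hy hp hpη (Or.inl rfl)
    (C_A := C) hA hB fun Λ => ?_
  have hΛ : 0 < max Λ 1 := lt_max_of_lt_right one_pos
  obtain ⟨r₁, -, hr₁⟩ := hex 1 one_pos
  obtain ⟨r₂, -, hr₂⟩ := hex (Real.exp (max Λ 1)) (Real.exp_pos _)
  have h1 : 0 < vol μ x₀ r₁ := by rw [hr₁]; exact one_pos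
  have h12 : vol μ x₀ r₁ < vol μ x₀ r₂ := by rw [hr₁, hr₂, Real.one_lt_exp_iff]; exact hΛ
  refine ⟨r₁, r₂, h1, h12, mem_univ _, ?_, fun y hy1 _ => ?_, hC r₁ r₂ hr₁.ge h12⟩
  · rw [hr₁, hr₂, div_one, Real.log_exp]
    exact le_max_left _ _
  · exact (hb x₀ y).1 (h1.trans_le (hv.vol_mono x₀ hy1))

end

end RieszLike

end

/-! ### Assembly of the sharpness theorem -/

theorem theorem2 {M : Type*} [MetricSpace M] [MeasurableSpace M] [BorelSpace M]
    (μ : MeasureTheory.Measure M) (hμ : μ ≠ 0) (hvol : RieszLike.HasContinuousVolume μ)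
    (k : M → M → ℝ) (β β' A₀ Ainf p : ℝ) (hβ : β.HolderConjugate β') (hp : 1 ≤ p)
    (hk : RieszLike.IsRieszLike μ k β A₀ Ainf ∨
      (Ainf = 0 ∧ RieszLike.IsCriticalRieszLike μ k β A₀))
    (x₀ : M) (η₁ η : ℝ) (hη₁ : 0 < η₁) (hη : 0 ≤ η)
    (hx : RieszLike.IsXRegularAt μ k β x₀ η₁)
    (hy : RieszLike.HasTaylorFormulaAt μ k β x₀ η)
    (hpη : (1 + p / β') * (1 + η)⁻¹ < p) :
    (RieszLike.IsProperOnDiagonalAt μ k β A₀ x₀ →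
      (Ainf ≤ A₀ →
        RieszLike.ExpConstantStronglySharp μ k β β' p 0 (max A₀ Ainf)⁻¹ ∧
        RieszLike.DenominatorPowerSharp μ k β β' p 0 (max A₀ Ainf)⁻¹) ∧
      (∀ κ : ℝ, 0 ≤ κ → (κ = 0 ∨ (1 + β' / β') * (1 + η)⁻¹ < β') →
        RieszLike.ExpConstantStronglySharp μ k β β' p κ A₀⁻¹ ∧
        RieszLike.DenominatorPowerSharp μ k β β' p κ A₀⁻¹ ∧
        RieszLike.RufConstantSharp μ k β β' κ A₀⁻¹)) ∧
    (RieszLike.IsProperAtInfinityAt μ k β Ainf x₀ → A₀ ≤ Ainf →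
      RieszLike.ExpConstantSharp μ k β β' p 0 (max A₀ Ainf)⁻¹ ∧
      RieszLike.DenominatorPowerSharp μ k β β' p 0 (max A₀ Ainf)⁻¹) := by
  have hp0 : 0 < p := zero_lt_one.trans_le hp
  have hpη' := RieszLike.one_lt_taylor_exponent hβ hη hpη
  have hA₀ : 0 < A₀ := hk.elim (fun h => h.A₀_pos) fun h => h.2.A₀_pos
  have hkm : Measurable (Function.uncurry k) :=
    hk.elim (fun h => h.measurable) fun h => h.2.measurable
  obtain ⟨K, hK, hw₁, hw₂⟩ : ∃ K ≥ 0, (∀ x, RieszLike.WeakOne μ (fun y => |k x y| ^ β) K) ∧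
      ∀ y, RieszLike.WeakOne μ (fun x => |k x y| ^ β) K :=
    hk.elim (fun h => h.exists_weakOne hvol) fun h => h.2.exists_weakOne
  obtain ⟨B, hB, hnear⟩ : ∃ B ≥ 0, RieszLike.PointwiseBoundNear μ k β B := by
    rcases hk with hk | ⟨-, hk⟩
    · obtain ⟨B, hB, -, -, hb⟩ := hk.size
      exact ⟨B, hB, fun x y h _ => (hb x y).1 h⟩
    · obtain ⟨B, hB, -, -, hb⟩ := hk.size
      exact ⟨B, hB, hb⟩
  refine ⟨fun hdiag => ?_, fun hinf hle => ?_⟩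
  -- The condition for `κ ≠ 0` is the hypothesis on `p` with `β'` in place of `p`: it makes the
  -- potential of the extremal lie in `L^{β'}`.
  · have main : ∀ κ : ℝ, 0 ≤ κ → (κ = 0 ∨ (1 + β' / β') * (1 + η)⁻¹ < β') →
        RieszLike.ExpConstantStronglySharp μ k β β' p κ A₀⁻¹ ∧
        RieszLike.DenominatorPowerSharp μ k β β' p κ A₀⁻¹ ∧
        RieszLike.RufConstantSharp μ k β β' κ A₀⁻¹ := by
      intro κ hκ0 hκ
      obtain ⟨ρ₀, h⟩ := hdiag.hasExtremals (κ := κ) hμ hvol hkm hβ hA₀ hp0 hK hw₁ hw₂ hB hnear hη₁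
        hη hx hy hpη' (hκ.imp_right fun h => ⟨RieszLike.one_lt_taylor_exponent hβ hη h, hκ0⟩)
      exact ⟨h.expConstantStronglySharp hβ hp0 hA₀, h.denominatorPowerSharp hβ hp0 hA₀,
        h.rufConstantSharp hβ hA₀⟩
    refine ⟨fun hle => ?_, main⟩
    rw [max_eq_left hle]
    exact ⟨(main 0 le_rfl (Or.inl rfl)).1, (main 0 le_rfl (Or.inl rfl)).2.1⟩
  -- The critical alternative has `Ainf = 0`, which properness at infinity excludes.
  · rcases hk with hk | ⟨h0, -⟩
    · have h := hinf.hasExtremals hvol hk hβ hp0 hη₁ hη hx hy hpη'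
      rw [max_eq_right hle]
      exact ⟨h.expConstantSharp hβ hp0 hinf.2.1, h.denominatorPowerSharp hβ hp0 hinf.2.1⟩
    · exact absurd hinf.2.1 (by rw [h0]; exact lt_irrefl 0)
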